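/- Let $V=V_{\bar 0}\oplus V_{\bar 1}$ be a complex superspace. Write an $\mathrm{End}(V)$-valued formal distribution as $A(z)=\sum_{n\in\mathbb Z}A_{(n)}z^{-n-1}$; it is a field if for every $v\in V$ one has $A_{(n)}v=0$ for $n$ large. For homogeneous $A,B$ put $p(A,B)=(-1)^{p(A)p(B)}$, and extend expressions such as $p(A,B)B(w)A(z)$ and $[A(z),B(w)]=A(z)B(w)-p(A,B)B(w)A(z)$ bilinearly to all $A,B$. A vertex algebra structure on $V$ consists of an even vector $|0\rangle$, an even endomorphism $T$ and a linear parity-preserving map $a\mapsto Y(a,z)=\sum_n a_{(n)}z^{-n-1}$ from $V$ to the $\mathrm{End}(V)$-valued fields such that $Y(|0\rangle,z)=\mathrm{Id}_V$, $Y(a,z)|0\rangle\in a+zV[[z]]$, $T|0\rangle=0$, $[T,Y(a,z)]=\partial_zY(a,z)$, and for all $a,b\in V$ there is $N\ge 0$ with $(z-w)^N[Y(a,z),Y(b,w)]=0$. For fields $A,B$ and $n\in\mathbb Z$, the generalized $n$-product is the field $$A(w)_{(n)}B(w)=\mathrm{Res}_z\Big(i_{z,w}(z-w)^n\,A(z)B(w)-i_{w,z}(z-w)^n\,p(A,B)\,B(w)A(z)\Big),$$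 where $i_{z,w}(z-w)^n=\sum_{j\ge0}\binom nj(-w)^jz^{n-j}$, $i_{w,z}(z-w)^n=\sum_{j\ge0}\binom nj z^j(-w)^{n-j}$ and $\mathrm{Res}_z$ is the coefficient of $z^{-1}$. The normally ordered product is ${:}A(z)B(z){:}=A(z)_+B(z)+p(A,B)B(z)A(z)_-$ with $A(z)_+=\sum_{n\le-1}A_{(n)}z^{-n-1}$ and $A(z)_-=\sum_{n\ge0}A_{(n)}z^{-n-1}$. Let $\delta(z,w)=\sum_{n\in\mathbb Z}z^{-n-1}w^n$. Theorem. Let $V$ be a vertex algebra and $a,b\in V$. Then $$Y(a_{(n)}b,z)=Y(a,z)_{(n)}Y(b,z)\qquad\text{for all }n\in\mathbb Z.$$ Moreover: (1) $Y(a_{(-1)}b,z)={:}Y(a,z)Y(b,z){:}$; (2) $Y(Ta,z)=\partial_zY(a,z)$; (3) $a_{(j)}b=0$ for all but finitely many $j\ge0$, and $[Y(a,z),Y(b,w)]=\sum_{j\ge0}Y(a_{(j)}b,w)\,\dfrac{\partial_w^j\delta(z,w)}{j!}$. -/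

import Mathlib

open Filter

noncomputable section

namespace VertexAlg

/-! ### Formal distributions in one and two variables

A one-variable formal distribution is stored through its modes: `a n` is the coefficient `a_(n)` of
`z ^ (-n - 1)`.  A two-variable one is stored in the same way: `X m n` is the coefficient of
`z ^ (-m - 1) * w ^ (-n - 1)`. -/

/-- `M[[z, z⁻¹]]`, by modes. -/
abbrev FDist (M : Type*) := ℤ → M

/-- `M[[z, z⁻¹, w, w⁻¹]]`, by modes. -/
abbrev FDist₂ (M : Type*) := ℤ → ℤ → M

section Formal

variable {M : Type*} [AddCommGroup M] [Module ℂ M]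

/-- The residue in `z`: the coefficient of `z⁻¹`, a formal distribution in `w`. -/
def resZ (X : FDist₂ M) : FDist M := X 0

/-- Multiplication by `z - w`. -/
def mulZSubW (X : FDist₂ M) : FDist₂ M := fun m n => X (m + 1) n - X m (n + 1)

/-- A two-variable formal distribution is local if `(z - w) ^ N` kills it for some `N`. -/
def IsLocal (X : FDist₂ M) : Prop := ∃ N : ℕ, mulZSubW^[N] X = 0

/-- The partial derivative in `w`. -/
def derivW (X : FDist₂ M) : FDist₂ M := fun m n => (-n : ℂ) • X m (n - 1)

/-- A one-variable formal distribution `c(w)`, seen in two variables (constant in `z`). -/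
def inW (c : FDist M) : FDist₂ M := fun m n => if m = -1 then c n else 0

/-- Specialisation `w = z` of a two-variable formal distribution: the coefficient of `z ^ (-k - 1)`
is the sum of all `X m n` with `(-m - 1) + (-n - 1) = -k - 1`.  It is only used where these sums
are finite. -/
def diag (X : FDist₂ M) : FDist M := fun k => ∑ᶠ m : ℤ, X m (k - 1 - m)

/-- The scalar formal distribution whose coefficient at `z ^ r * w ^ s` is `c r s`. -/
def ofPowers (c : ℤ → ℤ → ℂ) : FDist₂ ℂ := fun m n => c (-m - 1) (-n - 1)

/-- The coefficient at `z ^ r * w ^ s` of a scalar formal distribution. -/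
def powerCoeff (K : FDist₂ ℂ) (r s : ℤ) : ℂ := K (-r - 1) (-s - 1)

/-- The Cauchy product of a scalar formal distribution with an `M`-valued one: the term
`z ^ r * w ^ s` of `K` shifts the modes `(m, n)` by `(r, s)`.  It is only used where these sums are
finite. -/
def kmul (K : FDist₂ ℂ) (X : FDist₂ M) : FDist₂ M := fun m n =>
  ∑ᶠ p : ℤ × ℤ, powerCoeff K p.1 p.2 • X (m + p.1) (n + p.2)

/-- `i_{z,w} (z - w) ^ n = ∑_{s ≥ 0} (n choose s) (-w) ^ s z ^ (n - s)`. -/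
def expandZW (n : ℤ) : FDist₂ ℂ := ofPowers fun r s =>
  if 0 ≤ s ∧ r + s = n then (-1 : ℂ) ^ s * (Ring.choose n s.toNat : ℤ) else 0

/-- `i_{w,z} (z - w) ^ n = ∑_{r ≥ 0} (n choose r) z ^ r (-w) ^ (n - r)`. -/
def expandWZ (n : ℤ) : FDist₂ ℂ := ofPowers fun r s =>
  if 0 ≤ r ∧ r + s = n then (-1 : ℂ) ^ s * (Ring.choose n r.toNat : ℤ) else 0

/-- The formal delta distribution `δ(z,w) = ∑_{n ∈ ℤ} z ^ (-n - 1) w ^ n`. -/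
def delta : FDist₂ ℂ := ofPowers fun r s => if r + s = -1 then 1 else 0

/-- `∂_w ^ j δ(z,w) / j!`. -/
def deltaDeriv (j : ℕ) : FDist₂ ℂ := ((j.factorial : ℂ)⁻¹) • derivW^[j] delta

end Formal

/-! ### Superspaces -/

section Super

variable {V : Type*} [AddCommGroup V] [Module ℂ V] (𝒱 : ZMod 2 → Submodule ℂ V)
  [DirectSum.Decomposition 𝒱]

/-- The projection of the superspace `V` onto its part of parity `i`. -/
def parityProj (i : ZMod 2) : Module.End ℂ V :=
  (𝒱 i).subtype ∘ₗ DirectSum.component ℂ (ZMod 2) (fun i => 𝒱 i) i ∘ₗ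
    (DirectSum.decomposeLinearEquiv 𝒱).toLinearMap

/-- The component of parity `d` of an endomorphism: the part that maps `𝒱 i` to `𝒱 (i + d)`. -/
def parityPart (d : ZMod 2) (f : Module.End ℂ V) : Module.End ℂ V :=
  ∑ i : ZMod 2, parityProj 𝒱 (i + d) * f * parityProj 𝒱 i

/-- The bilinear extension of `(f, g) ↦ p(f, g) g f`, `p(f, g) = (-1) ^ (p(f) p(g))`, from
homogeneous to arbitrary endomorphisms. -/
def superSwap (f g : Module.End ℂ V) : Module.End ℂ V :=
  ∑ d : ZMod 2, ∑ e : ZMod 2, (-1 : ℂ) ^ (d.val * e.val) • (parityPart 𝒱 e g * parityPart 𝒱 d f)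

/-! ### Fields

An `End(V)`-valued field is Mathlib's `VertexOperator ℂ V` (a linear map from `V` to Laurent series
in `V`), and `A.ncoeff n` is its mode `A_(n)`, the coefficient of `z ^ (-n - 1)`. -/

/-- The supercommutator `[A(z), B(w)] = A(z) B(w) - p(A, B) B(w) A(z)`. -/
def superComm (A B : VertexOperator ℂ V) : FDist₂ (Module.End ℂ V) := fun m n =>
  A.ncoeff m * B.ncoeff n - superSwap 𝒱 (A.ncoeff m) (B.ncoeff n)

/-- `A(z) B(w) v`. -/
def prodVec (A B : VertexOperator ℂ V) (v : V) : FDist₂ V := fun m n =>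
  (A.ncoeff m * B.ncoeff n) v

/-- `p(A, B) B(w) A(z) v`. -/
def swapVec (A B : VertexOperator ℂ V) (v : V) : FDist₂ V := fun m n =>
  superSwap 𝒱 (A.ncoeff m) (B.ncoeff n) v

/-- `Res_z (i_{z,w} (z - w) ^ n A(z) B(w) - i_{w,z} (z - w) ^ n p(A, B) B(w) A(z)) v`. -/
def nProductVec (A B : VertexOperator ℂ V) (n : ℤ) (v : V) : FDist V :=
  resZ (kmul (expandZW n) (prodVec A B v) - kmul (expandWZ n) (swapVec 𝒱 A B v))

/-- `:A(z) B(w): v = A(z)_+ B(w) v + p(A, B) B(w) A(z)_- v`, where `A(z)_+` collects the modes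
`A_(m)` with `m ≤ -1` and `A(z)_-` those with `m ≥ 0`. -/
def normalVec (A B : VertexOperator ℂ V) (v : V) : FDist₂ V := fun m n =>
  if m ≤ -1 then prodVec A B v m n else swapVec 𝒱 A B v m n

/-- A field, from modes that are linear in the vector and vanish on it for large index. -/
def ofModes (f : V → FDist V) (hadd : ∀ u v k, f (u + v) k = f u k + f v k)
    (hsmul : ∀ (c : ℂ) v k, f (c • v) k = c • f v k)
    (hf : ∀ v, ∀ᶠ k in atTop, f v k = 0) : VertexOperator ℂ V :=
  VertexOperator.of_coeff
    (fun i => { toFun := fun v => f v (-i - 1)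
                map_add' := fun u v => hadd u v _
                map_smul' := fun c v => hsmul c v _ })
    (fun v => by
      obtain ⟨N, hN⟩ := eventually_atTop.1 (hf v)
      refine ⟨-N, fun i hi => ?_⟩
      by_contra h
      exact hi (hN _ (by lia)))

theorem ncoeff_ofModes (f : V → FDist V) (hadd hsmul hf) (k : ℤ) (v : V) :
    (ofModes f hadd hsmul hf).ncoeff k v = f v k := by
  rw [ofModes, VertexOperator.ncoeff_of_coeff]
  simp

theorem ncoeff_eventually (A : VertexOperator ℂ V) (v : V) :
    ∀ᶠ n in atTop, A.ncoeff n v = 0 := by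
  refine eventually_atTop.2 ⟨-(HahnSeries.order ((HahnModule.of ℂ).symm (A v))), fun n hn => ?_⟩
  exact A.ncoeff_eq_zero_of_lt_order n v (by lia)

theorem parityPart_eventually (A : VertexOperator ℂ V) (d : ZMod 2) (v : V) :
    ∀ᶠ n in atTop, parityPart 𝒱 d (A.ncoeff n) v = 0 := by
  have h : ∀ᶠ n in atTop, ∀ i : ZMod 2, A.ncoeff n (parityProj 𝒱 i v) = 0 :=
    eventually_all.2 fun i => ncoeff_eventually A _
  filter_upwards [h] with n hn
  simp [parityPart, LinearMap.sum_apply, hn]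

theorem prodVec_eventually (A B : VertexOperator ℂ V) (v : V) :
    ∀ᶠ n in atTop, ∀ m, prodVec A B v m n = 0 := by
  filter_upwards [ncoeff_eventually B v] with n hn m
  simp [prodVec, hn]

theorem swapVec_eventually (A B : VertexOperator ℂ V) (v : V) :
    ∀ᶠ m in atTop, ∀ n, swapVec 𝒱 A B v m n = 0 := by
  have h : ∀ᶠ m in atTop, ∀ d : ZMod 2, parityPart 𝒱 d (A.ncoeff m) v = 0 :=
    eventually_all.2 fun d => parityPart_eventually 𝒱 A d v
  filter_upwards [h] with m hm n
  simp [swapVec, superSwap, LinearMap.sum_apply, hm]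

theorem swapVec_eventually' (A B : VertexOperator ℂ V) (v : V) (m : ℤ) :
    ∀ᶠ n in atTop, swapVec 𝒱 A B v m n = 0 := by
  have h : ∀ᶠ n in atTop, ∀ e d : ZMod 2,
      parityPart 𝒱 e (B.ncoeff n) (parityPart 𝒱 d (A.ncoeff m) v) = 0 :=
    eventually_all.2 fun e => eventually_all.2 fun d => parityPart_eventually 𝒱 B e _
  filter_upwards [h] with n hn
  simp [swapVec, superSwap, LinearMap.sum_apply, hn]

theorem kmul_prodVec_finite (A B : VertexOperator ℂ V) (n m k : ℤ) (v : V) :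
    (Function.support fun p : ℤ × ℤ =>
      powerCoeff (expandZW n) p.1 p.2 • prodVec A B v (m + p.1) (k + p.2)).Finite := by
  obtain ⟨N, hN⟩ := eventually_atTop.1 (prodVec_eventually A B v)
  refine ((Set.finite_Icc 0 (N - k)).image fun s => (n - s, s)).subset ?_
  rintro ⟨r, s⟩ h
  have h1 : 0 ≤ s ∧ r + s = n := by
    by_contra h'
    exact h (by simp [powerCoeff, expandZW, ofPowers, h'])
  have h2 : k + s < N := by
    by_contra h'
    exact h (by simp [hN (k + s) (by lia)])
  exact ⟨s, ⟨h1.1, by lia⟩, by ext <;> simp; lia⟩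

theorem kmul_swapVec_finite (A B : VertexOperator ℂ V) (n m k : ℤ) (v : V) :
    (Function.support fun p : ℤ × ℤ =>
      powerCoeff (expandWZ n) p.1 p.2 • swapVec 𝒱 A B v (m + p.1) (k + p.2)).Finite := by
  obtain ⟨N, hN⟩ := eventually_atTop.1 (swapVec_eventually 𝒱 A B v)
  refine ((Set.finite_Icc 0 (N - m)).image fun r => (r, n - r)).subset ?_
  rintro ⟨r, s⟩ h
  have h1 : 0 ≤ r ∧ r + s = n := by
    by_contra h'
    exact h (by simp [powerCoeff, expandWZ, ofPowers, h'])
  have h2 : m + r < N := by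
    by_contra h'
    exact h (by simp [hN (m + r) (by lia)])
  exact ⟨r, ⟨h1.1, by lia⟩, by ext <;> simp; lia⟩

theorem normalVec_finite (A B : VertexOperator ℂ V) (k : ℤ) (v : V) :
    (Function.support fun m : ℤ => normalVec 𝒱 A B v m (k - 1 - m)).Finite := by
  obtain ⟨N, hN⟩ := eventually_atTop.1 (prodVec_eventually A B v)
  obtain ⟨N', hN'⟩ := eventually_atTop.1 (swapVec_eventually 𝒱 A B v)
  refine ((Set.finite_Icc (k - 1 - N) 0).union (Set.finite_Icc 0 N')).subset ?_
  intro m h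
  by_cases hm : m ≤ -1
  · refine Or.inl ⟨?_, by lia⟩
    by_contra h'
    exact h (by simp [normalVec, hm, hN (k - 1 - m) (by lia)])
  · refine Or.inr ⟨by lia, ?_⟩
    by_contra h'
    exact h (by simp [normalVec, hm, hN' m (by lia)])

/-- The generalized `n`-product `A(w)_(n) B(w)` of two fields, `n ∈ ℤ`, again a field:
`Res_z (i_{z,w} (z - w) ^ n A(z) B(w) - i_{w,z} (z - w) ^ n p(A, B) B(w) A(z))`. -/
def nProduct (A B : VertexOperator ℂ V) (n : ℤ) : VertexOperator ℂ V :=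
  ofModes (nProductVec 𝒱 A B n)
    (by
      intro u v k
      have h1 := finsum_add_distrib (kmul_prodVec_finite A B n 0 k u)
        (kmul_prodVec_finite A B n 0 k v)
      have h2 := finsum_add_distrib (kmul_swapVec_finite 𝒱 A B n 0 k u)
        (kmul_swapVec_finite 𝒱 A B n 0 k v)
      simp only [nProductVec, resZ, kmul, Pi.sub_apply]
      rw [sub_add_sub_comm, ← h1, ← h2]
      simp only [prodVec, swapVec, map_add, smul_add])
    (by
      intro c v k
      simp only [nProductVec, resZ, kmul, Pi.sub_apply, smul_sub, smul_finsum, prodVec, swapVec,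
        map_smul, smul_comm c])
    (by
      intro v
      obtain ⟨N, hN⟩ := eventually_atTop.1 (prodVec_eventually A B v)
      obtain ⟨M, hM⟩ := eventually_atTop.1 (swapVec_eventually 𝒱 A B v)
      have h : ∀ᶠ k in atTop, ∀ r ∈ Finset.Icc 0 M, swapVec 𝒱 A B v r (k + (n - r)) = 0 :=
        (Finset.eventually_all _).2 fun r _ =>
          (tendsto_atTop_add_const_right atTop (n - r) tendsto_id).eventually
            (swapVec_eventually' 𝒱 A B v r)
      filter_upwards [h, eventually_ge_atTop N] with k hk hkN
      simp only [nProductVec, resZ, kmul, Pi.sub_apply]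
      rw [finsum_eq_zero_of_forall_eq_zero, finsum_eq_zero_of_forall_eq_zero, sub_zero]
      · rintro ⟨r, s⟩
        by_cases h1 : 0 ≤ r ∧ r + s = n
        · obtain rfl : s = n - r := by lia
          by_cases h2 : r ≤ M
          · simp [hk r (Finset.mem_Icc.2 ⟨h1.1, h2⟩)]
          · simp [hM r (by lia)]
        · simp [powerCoeff, expandWZ, ofPowers, h1]
      · rintro ⟨r, s⟩
        by_cases h1 : 0 ≤ s ∧ r + s = n
        · simp [hN (k + s) (by lia)]
        · simp [powerCoeff, expandZW, ofPowers, h1])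

/-- The normally ordered product `:A(z) B(z):` of two fields, again a field. -/
def normalProduct (A B : VertexOperator ℂ V) : VertexOperator ℂ V :=
  ofModes (fun v => diag (normalVec 𝒱 A B v))
    (by
      intro u v k
      have h := finsum_add_distrib (normalVec_finite 𝒱 A B k u)
        (normalVec_finite 𝒱 A B k v)
      simp only [diag]
      rw [← h]
      refine finsum_congr fun m => ?_
      simp only [normalVec, prodVec, swapVec, map_add]
      split_ifs <;> rfl)
    (by
      intro c v k
      simp only [diag, smul_finsum]
      refine finsum_congr fun m => ?_
      simp only [normalVec, prodVec, swapVec, map_smul]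
      split_ifs <;> rfl)
    (by
      intro v
      obtain ⟨N, hN⟩ := eventually_atTop.1 (prodVec_eventually A B v)
      obtain ⟨M, hM⟩ := eventually_atTop.1 (swapVec_eventually 𝒱 A B v)
      have h : ∀ᶠ k in atTop, ∀ m ∈ Finset.Icc 0 M, swapVec 𝒱 A B v m (k + (-1 - m)) = 0 :=
        (Finset.eventually_all _).2 fun m _ =>
          (tendsto_atTop_add_const_right atTop (-1 - m) tendsto_id).eventually
            (swapVec_eventually' 𝒱 A B v m)
      filter_upwards [h, eventually_ge_atTop N] with k hk hkN
      refine finsum_eq_zero_of_forall_eq_zero fun m => ?_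
      by_cases hm : m ≤ -1
      · simp [normalVec, hm, hN (k - 1 - m) (by lia)]
      · by_cases h2 : m ≤ M
        · have := hk m (Finset.mem_Icc.2 ⟨by lia, h2⟩)
          rw [show k + (-1 - m) = k - 1 - m by ring] at this
          simp [normalVec, hm, this]
        · simp [normalVec, hm, hM m (by lia)])

/-- The derivative `∂_z A(z)` of a field; its modes are `(∂A)_(n) = -n A_(n-1)`. -/
def fieldDeriv (A : VertexOperator ℂ V) : VertexOperator ℂ V :=
  ofModes (fun v n => (-n : ℂ) • A.ncoeff (n - 1) v)
    (fun u v k => by simp only [map_add, smul_add])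
    (fun c v k => by simp only [map_smul, smul_comm c])
    (fun v => by
      filter_upwards [(tendsto_atTop_add_const_right atTop (-1 : ℤ) tendsto_id).eventually
        (ncoeff_eventually A v)] with n hn
      have hn' : A.ncoeff (n - 1) v = 0 := hn
      simp [hn'])

/-! ### Vertex algebras -/

/-- A vertex (super)algebra structure `(|0⟩, T, Y)` on the complex superspace `V = 𝒱 0 ⊕ 𝒱 1`. -/
structure VertexAlgebra where
  /-- The vacuum vector. -/
  vac : V
  vac_even : vac ∈ 𝒱 0
  /-- The infinitesimal translation operator. -/
  T : Module.End ℂ V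
  T_even : ∀ i, ∀ v ∈ 𝒱 i, T v ∈ 𝒱 i
  /-- The state-field correspondence. -/
  Y : V →ₗ[ℂ] VertexOperator ℂ V
  Y_parity : ∀ i j, ∀ a ∈ 𝒱 i, ∀ b ∈ 𝒱 j, ∀ n, (Y a).ncoeff n b ∈ 𝒱 (i + j)
  /-- `Y(|0⟩, z) = Id`. -/
  Y_vac : ∀ n, (Y vac).ncoeff n = if n = -1 then 1 else 0
  /-- `Y(a, z)|0⟩` has no negative powers of `z`. -/
  Y_apply_vac_regular : ∀ a, ∀ n : ℤ, 0 ≤ n → (Y a).ncoeff n vac = 0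
  /-- The constant term of `Y(a, z)|0⟩` is `a`. -/
  Y_apply_vac : ∀ a, (Y a).ncoeff (-1) vac = a
  T_vac : T vac = 0
  /-- Translation covariance `[T, Y(a, z)] = ∂_z Y(a, z)`. -/
  translation : ∀ a n, T * (Y a).ncoeff n - (Y a).ncoeff n * T = (fieldDeriv (Y a)).ncoeff n
  /-- `(z - w) ^ N [Y(a, z), Y(b, w)] = 0` for large `N`. -/
  locality : ∀ a b, IsLocal (superComm 𝒱 (Y a) (Y b))

end Super

end VertexAlg

end

/-! The core is the identity `Y_ncoeff`, proved by Goddard's uniqueness argument. Let D(z) be the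
difference of the two sides for homogeneous a and b. Three facts force D(z)c = 0 for every
homogeneous c. On the vacuum, D(z)|0⟩ = 0 (`nProduct_vac`): both sides have no negative powers of z,
have constant term a_(n)b, and satisfy T d = ∂d, which determines all remaining coefficients
(`eq_zero_of_translation`). Both sides are local with Y(c,x) when applied to the vacuum: one by the
locality axiom, the other by Dong's lemma (`dong`, `nProduct_locality`). Hence (z-x)^L D(z)Y(c,x)|0⟩
= 0 for large L. Finally, Y(c,x)|0⟩ has no negative powers of x and has constant term c, so setting
x = 0 leaves z^L D(z)c = 0 (`eq_zero_of_mulZSubW_iterate`).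

The rest follows from the identity. For n = -1 the two expansions of (z-w)^(-1) split A into A_+ and
A_-. Since Ta = a_(-2)|0⟩, the case n = -2 against the identity field gives ∂Y(a,z). For n = j ≥ 0
both expansions are the same polynomial, so Y(a_(j)b,w) is the residue of (z-w)^j times the
supercommutator; a local distribution is recovered from these residues by Newton's difference
formula (`eq_sum_choose_of_isLocal`), whose binomials are the coefficients of the divided
derivatives of δ. -/

noncomputable section

namespace VertexAlg

/-! ### Signed binomial coefficients -/

/-- The coefficient `(-1) ^ j * (n choose j)` of `w ^ j * z ^ (n - j)` in `i_{z,w} (z - w) ^ n`. -/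
def expandCoeff (n : ℤ) (j : ℕ) : ℂ := (-1) ^ j * (Ring.choose n j : ℤ)

theorem expandCoeff_zero_right (n : ℤ) : expandCoeff n 0 = 1 := by
  simp [expandCoeff]

theorem expandCoeff_zero_succ (j : ℕ) : expandCoeff 0 (j + 1) = 0 := by
  simp [expandCoeff]

theorem expandCoeff_succ_succ (n : ℤ) (j : ℕ) :
    expandCoeff (n + 1) (j + 1) = expandCoeff n (j + 1) - expandCoeff n j := by
  simp only [expandCoeff, Ring.choose_succ_succ, pow_succ]
  push_cast
  ring

theorem succ_mul_choose_succ (n : ℤ) (j : ℕ) :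
    (j + 1 : ℂ) * (Ring.choose n (j + 1) : ℤ) = (n - j : ℂ) * (Ring.choose n j : ℤ) := by
  have h := Ring.choose_smul_choose n (Nat.le_succ j)
  simp only [Nat.succ_eq_add_one, Nat.choose_succ_self_right, Nat.add_sub_cancel_left,
    Ring.choose_one_right, nsmul_eq_mul] at h
  rw [mul_comm (Ring.choose n j)] at h
  exact_mod_cast h

/-- On coefficients, this says that ∂_z + ∂_w annihilates the expansion of (z-w)^n. -/
theorem expandCoeff_absorb (n : ℤ) (j : ℕ) :
    (j + 1 : ℂ) * expandCoeff n (j + 1) = -((n - j : ℂ) * expandCoeff n j) := by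
  simp only [expandCoeff, pow_succ]
  linear_combination (-1) ^ j * (-1) * succ_mul_choose_succ n j

theorem expandCoeff_neg_one (j : ℕ) : expandCoeff (-1) j = 1 := by
  induction j with
  | zero => exact expandCoeff_zero_right _
  | succ j ih =>
    have h := expandCoeff_succ_succ (-1) j
    rw [ih] at h
    have h0 := expandCoeff_zero_succ j
    norm_num at h
    rw [h0] at h
    linear_combination -h

theorem expandCoeff_neg_two (j : ℕ) : expandCoeff (-2) j = j + 1 := by
  induction j with
  | zero => simp [expandCoeff_zero_right]
  | succ j ih =>
    have h := expandCoeff_succ_succ (-2) j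
    norm_num at h
    rw [ih, expandCoeff_neg_one] at h
    push_cast
    linear_combination -h

/-! ### Locality and truncation in two variables -/

section Formal

variable {M : Type*} [AddCommGroup M]

theorem mulZSubW_add (X X' : FDist₂ M) : mulZSubW (X + X') = mulZSubW X + mulZSubW X' := by
  ext m k
  simp only [mulZSubW, Pi.add_apply]
  abel

/-- Multiplication by z - w is a forward difference along the antidiagonals m + n = const, so its
kernel consists of distributions constant along them, the multiples c(w)δ(z,w). -/
theorem eq_of_mulZSubW_eq_zero {X : FDist₂ M} (h : mulZSubW X = 0) (m n : ℤ) :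
    X m n = X 0 (m + n) := by
  have h1 : ∀ m n, X (m + 1) n = X m (n + 1) := fun m n =>
    sub_eq_zero.1 (congrFun (congrFun h m) n)
  induction m generalizing n with
  | zero => rw [zero_add]
  | succ i ih => rw [h1, ih]; congr 1; ring
  | pred i ih =>
    have := h1 (-i - 1) (n - 1)
    rw [sub_add_cancel, sub_add_cancel] at this
    rw [← this, ih]; congr 1; ring

/-- If `(z - w) ^ N` kills `X` and `X` has no negative powers of `w`, its constant term in `w`
vanishes. -/
theorem eq_zero_of_mulZSubW_iterate (N : ℕ) {X : FDist₂ M} (h : mulZSubW^[N] X = 0)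
    (h0 : ∀ m, ∀ n : ℤ, 0 ≤ n → X m n = 0) (m : ℤ) : X m (-1) = 0 := by
  induction N generalizing X m with
  | zero => exact congrFun (congrFun h m) (-1)
  | succ N ih =>
    -- At w-mode -1 the w-term of (z-w)X is the mode 0 of X, which vanishes; only a shift in z
    -- remains.
    have := ih (X := mulZSubW X) h (fun m n hn => by
      rw [mulZSubW, h0 _ _ hn, h0 _ _ (by lia), sub_zero]) (m - 1)
    rwa [mulZSubW, h0 (m - 1) (-1 + 1) (by lia), sub_zero, sub_add_cancel] at this

/-- The `w`-modes vanish for large index, uniformly in `z`. -/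
def TruncW (X : FDist₂ M) : Prop := ∀ᶠ k in atTop, ∀ m, X m k = 0

theorem TruncW.exists_bound {X : FDist₂ M} (h : TruncW X) (k : ℤ) :
    ∃ N : ℕ, ∀ j : ℕ, N ≤ j → ∀ m, X m (k + j) = 0 := by
  obtain ⟨B, hB⟩ := eventually_atTop.1 h
  exact ⟨(B - k).toNat, fun j hj m => hB _ (by lia) m⟩

variable [Module ℂ M]

/-! ### Multiplication by `(z - w) ^ n` -/

/-- Multiplication by `i_{z,w} (z - w) ^ n`. -/
def expandMul (n : ℤ) (X : FDist₂ M) : FDist₂ M := fun m k =>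
  ∑ᶠ j : ℕ, expandCoeff n j • X (m + n - j) (k + j)

/-- Exchange of the two variables. -/
def swapVars (X : FDist₂ M) : FDist₂ M := fun m k => X k m

theorem expandMul_eq_sum (n : ℤ) {X : FDist₂ M} {k : ℤ} {N : ℕ}
    (h : ∀ j : ℕ, N ≤ j → ∀ m, X m (k + j) = 0) (m : ℤ) :
    expandMul n X m k = ∑ j ∈ Finset.range N, expandCoeff n j • X (m + n - j) (k + j) := by
  refine finsum_eq_sum_of_support_subset _ fun j hj => ?_
  by_contra hj'
  exact hj (by simp [h j (by simpa using hj')])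

theorem expandMul_zero_left (X : FDist₂ M) : expandMul 0 X = X := by
  ext m k
  rw [expandMul, finsum_eq_single _ 0]
  · simp [expandCoeff_zero_right]
  · rintro (_ | j) hj
    · exact absurd rfl hj
    · simp [expandCoeff_zero_succ]

theorem expandMul_zero_right (n : ℤ) : expandMul n (0 : FDist₂ M) = 0 := by
  ext m k
  simp [expandMul]

theorem expandMul_add (n : ℤ) {X X' : FDist₂ M} (h : TruncW X) (h' : TruncW X') :
    expandMul n (X + X') = expandMul n X + expandMul n X' := by
  ext m k
  obtain ⟨N, hN⟩ := h.exists_bound k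
  obtain ⟨N', hN'⟩ := h'.exists_bound k
  have h1 : ∀ j : ℕ, max N N' ≤ j → ∀ m, X m (k + j) = 0 := fun j hj => hN j (by lia)
  have h2 : ∀ j : ℕ, max N N' ≤ j → ∀ m, X' m (k + j) = 0 := fun j hj => hN' j (by lia)
  have h3 : ∀ j : ℕ, max N N' ≤ j → ∀ m, (X + X') m (k + j) = 0 := fun j hj m => by
    simp [h1 j hj m, h2 j hj m]
  rw [Pi.add_apply, Pi.add_apply, expandMul_eq_sum n h1, expandMul_eq_sum n h2,
    expandMul_eq_sum n h3, ← Finset.sum_add_distrib]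
  simp

theorem expandMul_smul (n : ℤ) (c : ℂ) (X : FDist₂ M) :
    expandMul n (c • X) = c • expandMul n X := by
  ext m k
  -- No truncation is needed: over a field, scaling either preserves the support or makes everything
  -- zero.
  simp [expandMul, smul_finsum, smul_comm c]

theorem expandMul_sub (n : ℤ) {X X' : FDist₂ M} (h : TruncW X) (h' : TruncW X') :
    expandMul n (X - X') = expandMul n X - expandMul n X' := by
  have h'' : TruncW ((-1 : ℂ) • X') := by
    filter_upwards [h'] with k hk m
    simp [hk m]
  rw [sub_eq_add_neg, ← neg_one_smul ℂ X', expandMul_add n h h'', expandMul_smul, neg_one_smul,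
    sub_eq_add_neg]

theorem expandMul_map {M' : Type*} [AddCommGroup M'] [Module ℂ M'] (f : M →ₗ[ℂ] M') (n : ℤ)
    {X : FDist₂ M} (h : TruncW X) (m k : ℤ) :
    expandMul n (fun m k => f (X m k)) m k = f (expandMul n X m k) := by
  obtain ⟨N, hN⟩ := h.exists_bound k
  rw [expandMul_eq_sum n hN, expandMul_eq_sum n (X := fun m k => f (X m k)) (N := N)
    (fun j hj m => by simp [hN j hj m])]
  simp

/-- Pascal's rule for the signed binomials. Truncation makes each coefficient a finite sum that can
be reindexed. -/
theorem mulZSubW_expandMul (n : ℤ) {X : FDist₂ M} (h : TruncW X) :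
    mulZSubW (expandMul n X) = expandMul (n + 1) X := by
  ext m k
  obtain ⟨N, hN⟩ := h.exists_bound k
  -- Cutting at N + 1 for mode k and at N for mode k + 1 makes the sums match after splitting off j
  -- = 0.
  have h1 : ∀ j : ℕ, N + 1 ≤ j → ∀ m, X m (k + j) = 0 := fun j hj => hN j (by lia)
  have h2 : ∀ j : ℕ, N ≤ j → ∀ m, X m (k + 1 + j) = 0 := fun j hj m => by
    have := hN (j + 1) (by lia) m
    push_cast at this
    rwa [add_comm (j : ℤ) 1, ← add_assoc] at this
  rw [mulZSubW, expandMul_eq_sum n h1, expandMul_eq_sum n h2, expandMul_eq_sum (n + 1) h1,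
    Finset.sum_range_succ', Finset.sum_range_succ', expandCoeff_zero_right, expandCoeff_zero_right,
    add_sub_right_comm, ← Finset.sum_sub_distrib]
  congr 1
  · refine Finset.sum_congr rfl fun j _ => ?_
    rw [expandCoeff_succ_succ, sub_smul]
    push_cast
    congr 3 <;> ring
  · congr 2; ring

theorem mulZSubW_iterate_expandMul (n : ℤ) (p : ℕ) {X : FDist₂ M} (h : TruncW X) :
    mulZSubW^[p] (expandMul n X) = expandMul (n + p) X := by
  induction p with
  | zero => simp
  | succ p ih =>
    rw [Function.iterate_succ_apply', ih, mulZSubW_expandMul _ h]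
    push_cast
    rw [add_assoc]

theorem expandMul_natCast (p : ℕ) {X : FDist₂ M} (h : TruncW X) :
    expandMul p X = mulZSubW^[p] X := by
  rw [← zero_add (p : ℤ), ← mulZSubW_iterate_expandMul 0 p h, expandMul_zero_left]

theorem mulZSubW_smul (c : ℂ) (X : FDist₂ M) : mulZSubW (c • X) = c • mulZSubW X := by
  ext m k
  simp only [mulZSubW, Pi.smul_apply, smul_sub]

theorem mulZSubW_swapVars (X : FDist₂ M) :
    mulZSubW (swapVars X) = (-1 : ℂ) • swapVars (mulZSubW X) := by
  ext m k
  simp [mulZSubW, swapVars]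

/-- Multiplication by `z - w`, as a linear map. -/
def mulZSubWLin : Module.End ℂ (FDist₂ M) where
  toFun := mulZSubW
  map_add' := mulZSubW_add
  map_smul' := mulZSubW_smul

theorem mulZSubWLin_pow (p : ℕ) (X : FDist₂ M) : (mulZSubWLin ^ p) X = mulZSubW^[p] X := by
  rw [Module.End.pow_apply]; rfl

theorem mulZSubW_iterate_eq_zero_of_le {X : FDist₂ M} {p q : ℕ}
    (hpq : p ≤ q) (h : mulZSubW^[p] X = 0) : mulZSubW^[q] X = 0 := by
  obtain ⟨r, rfl⟩ := Nat.exists_eq_add_of_le' hpq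
  rw [Function.iterate_add_apply, h, ← mulZSubWLin_pow, map_zero]

theorem mulZSubW_iterate_swapVars (p : ℕ) (X : FDist₂ M) :
    mulZSubW^[p] (swapVars X) = (-1 : ℂ) ^ p • swapVars (mulZSubW^[p] X) := by
  induction p with
  | zero => simp
  | succ p ih =>
    rw [Function.iterate_succ_apply', ih, mulZSubW_smul, mulZSubW_swapVars,
      ← Function.iterate_succ_apply' mulZSubW, smul_smul, pow_succ]

/-- Multiplication by `i_{w,z} (z - w) ^ n`. -/
def expandMul' (n : ℤ) (X : FDist₂ M) : FDist₂ M :=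
  (-1 : ℂ) ^ n • swapVars (expandMul n (swapVars X))

theorem mulZSubW_iterate_expandMul' (n : ℤ) (p : ℕ) {X : FDist₂ M} (h : TruncW (swapVars X)) :
    mulZSubW^[p] (expandMul' n X) = expandMul' (n + p) X := by
  rw [expandMul', ← mulZSubWLin_pow, map_smul, mulZSubWLin_pow, mulZSubW_iterate_swapVars,
    mulZSubW_iterate_expandMul _ _ h, expandMul', smul_smul, zpow_add₀ (by norm_num), zpow_natCast]

theorem expandMul'_natCast (p : ℕ) {X : FDist₂ M} (h : TruncW (swapVars X)) :
    expandMul' p X = mulZSubW^[p] X := by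
  rw [← zero_add (p : ℤ), ← mulZSubW_iterate_expandMul' 0 p h, expandMul', expandMul_zero_left,
    zpow_zero, one_smul]
  rfl

theorem expandMul'_zero_right (n : ℤ) : expandMul' n (0 : FDist₂ M) = 0 := by
  change (-1 : ℂ) ^ n • swapVars (expandMul n (0 : FDist₂ M)) = 0
  rw [expandMul_zero_right]
  exact smul_zero _

theorem expandMul'_add (n : ℤ) {X X' : FDist₂ M} (h : TruncW (swapVars X))
    (h' : TruncW (swapVars X')) :
    expandMul' n (X + X') = expandMul' n X + expandMul' n X' := by
  rw [expandMul', show swapVars (X + X') = swapVars X + swapVars X' from rfl, expandMul_add n h h',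
    expandMul', expandMul', ← smul_add]
  rfl

theorem expandMul'_sub (n : ℤ) {X X' : FDist₂ M} (h : TruncW (swapVars X))
    (h' : TruncW (swapVars X')) :
    expandMul' n (X - X') = expandMul' n X - expandMul' n X' := by
  rw [expandMul', show swapVars (X - X') = swapVars X - swapVars X' from rfl, expandMul_sub n h h',
    expandMul', expandMul', ← smul_sub]
  rfl

theorem expandMul'_map {M' : Type*} [AddCommGroup M'] [Module ℂ M'] (f : M →ₗ[ℂ] M') (n : ℤ)
    {X : FDist₂ M} (h : TruncW (swapVars X)) (m k : ℤ) :
    expandMul' n (fun m k => f (X m k)) m k = f (expandMul' n X m k) := by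
  have := expandMul_map f n h k m
  simp only [expandMul', Pi.smul_apply, map_smul]
  exact congrArg _ this

/-- If `(z - w) ^ N` identifies two distributions, then a power of `z - w` identifies their products
with the two expansions of `(z - w) ^ n`. -/
theorem mulZSubW_iterate_expandMul_sub (n : ℤ) {N : ℕ} {X X' : FDist₂ M} (h : TruncW X)
    (h' : TruncW (swapVars X')) (hN : mulZSubW^[N] (X - X') = 0) :
    mulZSubW^[N + n.natAbs] (expandMul n X - expandMul' n X') = 0 := by
  -- Here q = n + |n| ≥ 0: the total exponent is natural, where both expansions are the same
  -- polynomial, and at least N.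
  obtain ⟨q, hq⟩ : ∃ q : ℕ, n + (N + n.natAbs : ℕ) = ((q + N : ℕ) : ℤ) :=
    ⟨(n + n.natAbs).toNat, by lia⟩
  rw [← mulZSubWLin_pow, map_sub, mulZSubWLin_pow, mulZSubWLin_pow, mulZSubW_iterate_expandMul n _ h,
    mulZSubW_iterate_expandMul' n _ h', hq, expandMul_natCast _ h, expandMul'_natCast _ h',
    ← mulZSubWLin_pow, ← mulZSubWLin_pow, ← map_sub, pow_add, Module.End.mul_apply,
    mulZSubWLin_pow N, hN, map_zero]

theorem mulZSubW_iterate_map {M' : Type*} [AddCommGroup M'] [Module ℂ M'] (f : M →ₗ[ℂ] M') (p : ℕ)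
    (X : FDist₂ M) : mulZSubW^[p] (fun m k => f (X m k)) = fun m k => f (mulZSubW^[p] X m k) := by
  induction p with
  | zero => rfl
  | succ p ih =>
    rw [Function.iterate_succ_apply', ih, Function.iterate_succ_apply']
    ext m k
    simp [mulZSubW]

/-! ### Newton's forward difference formula -/

/-- The forward difference of (m choose j+1) in m is (m choose j), so z - w lowers the order of each
delta derivative by one. -/
theorem mulZSubW_sum_choose (N : ℕ) (c : ℕ → FDist M) :
    mulZSubW (fun m n => ∑ j ∈ Finset.range (N + 1), ((Ring.choose m j : ℤ) : ℂ) • c j (m + n - j))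
      = fun m n => ∑ j ∈ Finset.range N,
          ((Ring.choose m j : ℤ) : ℂ) • c (j + 1) (m + n - j) := by
  ext m n
  rw [mulZSubW, ← Finset.sum_sub_distrib, Finset.sum_range_succ']
  have h0 : ((Ring.choose (m + 1) 0 : ℤ) : ℂ) • c 0 (m + 1 + n - (0 : ℕ)) -
      ((Ring.choose m 0 : ℤ) : ℂ) • c 0 (m + (n + 1) - (0 : ℕ)) = 0 := by
    rw [Ring.choose_zero_right, Ring.choose_zero_right, show m + (n + 1) = m + 1 + n by ring,
      sub_self]
  rw [h0, add_zero]
  refine Finset.sum_congr rfl fun j _ => ?_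
  rw [Ring.choose_succ_succ, show m + 1 + n - ((j + 1 : ℕ) : ℤ) = m + n - j by push_cast; ring,
    show m + (n + 1) - ((j + 1 : ℕ) : ℤ) = m + n - j by push_cast; ring, ← sub_smul]
  congr 1
  push_cast
  ring

theorem eq_sum_choose_of_isLocal (N : ℕ) {X : FDist₂ M} (h : mulZSubW^[N] X = 0) (m n : ℤ) :
    X m n = ∑ j ∈ Finset.range N,
      ((Ring.choose m j : ℤ) : ℂ) • mulZSubW^[j] X 0 (m + n - j) := by
  induction N generalizing X m n with
  | zero => simpa using congrFun (congrFun h m) n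
  | succ N ih =>
    set R : FDist₂ M := fun m n => ∑ j ∈ Finset.range (N + 1),
      ((Ring.choose m j : ℤ) : ℂ) • mulZSubW^[j] X 0 (m + n - j) with hR
    -- The induction hypothesis for (z-w)X shows that X and R have the same difference; being equal
    -- at m = 0, they coincide.
    have h1 : mulZSubW (X - R) = 0 := by
      rw [show mulZSubW (X - R) = mulZSubW X - mulZSubW R from map_sub mulZSubWLin X R, sub_eq_zero]
      rw [hR, mulZSubW_sum_choose N fun j => mulZSubW^[j] X 0]
      ext m n
      exact ih (X := mulZSubW X) h m n
    have h2 := eq_of_mulZSubW_eq_zero h1 m n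
    have h3 : R 0 (m + n) = X 0 (m + n) := by
      rw [hR]
      simp only
      rw [Finset.sum_range_succ', Finset.sum_eq_zero fun j _ => by simp]
      simp
    rw [Pi.sub_apply, Pi.sub_apply, Pi.sub_apply, Pi.sub_apply, h3, sub_self] at h2
    exact sub_eq_zero.1 h2

end Formal

/-! ### Dong's lemma -/

section Dong

variable {M : Type*} [AddCommGroup M]

/-- Multiplication by `z` on modes. -/
def shiftZ (X : FDist₂ M) : FDist₂ M := fun m k => X (m + 1) k

/-- Multiplication by `w` on modes. -/
def shiftW (X : FDist₂ M) : FDist₂ M := fun m k => X m (k + 1)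

theorem TruncW.sub {X X' : FDist₂ M} (h : TruncW X) (h' : TruncW X') : TruncW (X - X') := by
  filter_upwards [h, h'] with k hk hk' m
  simp [hk m, hk' m]

theorem TruncW.shiftZ {X : FDist₂ M} (h : TruncW X) : TruncW (shiftZ X) := by
  filter_upwards [h] with k hk m
  exact hk _

theorem TruncW.shiftW {X : FDist₂ M} (h : TruncW X) : TruncW (shiftW X) := by
  filter_upwards [(tendsto_atTop_add_const_right atTop (1 : ℤ) tendsto_id).eventually h] with k hk m
  exact hk m

variable [Module ℂ M]

/-! ### Three variables

A distribution in `z`, `w`, `x` is stored as `F l m k` with `l`, `m`, `k` the modes in `x`, `z`,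
`w`. -/

/-- Multiplication by `z - w` in three variables. -/
def subZW : Module.End ℂ (ℤ → FDist₂ M) where
  toFun F l m k := F l (m + 1) k - F l m (k + 1)
  map_add' F G := by ext; simp only [Pi.add_apply]; abel
  map_smul' c F := by ext; simp only [Pi.smul_apply, smul_sub, RingHom.id_apply]

/-- Multiplication by `z - x` in three variables. -/
def subZX : Module.End ℂ (ℤ → FDist₂ M) where
  toFun F l m k := F l (m + 1) k - F (l + 1) m k
  map_add' F G := by ext; simp only [Pi.add_apply]; abel
  map_smul' c F := by ext; simp only [Pi.smul_apply, smul_sub, RingHom.id_apply]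

/-- Multiplication by `w - x` in three variables. -/
def subWX : Module.End ℂ (ℤ → FDist₂ M) where
  toFun F l m k := F l m (k + 1) - F (l + 1) m k
  map_add' F G := by ext; simp only [Pi.add_apply]; abel
  map_smul' c F := by ext; simp only [Pi.smul_apply, smul_sub, RingHom.id_apply]

/-- The relation w - x = (z - x) - (z - w) that drives Dong's lemma. -/
theorem subWX_eq : (subWX : Module.End ℂ (ℤ → FDist₂ M)) = subZX - subZW := by
  ext F l m k
  simp [subWX, subZX, subZW]

theorem commute_subZW_subZX : Commute (subZW : Module.End ℂ (ℤ → FDist₂ M)) subZX := by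
  refine LinearMap.ext fun F => ?_
  ext l m k
  simp only [subZX, subZW, Module.End.mul_apply, LinearMap.coe_mk, AddHom.coe_mk]
  abel

theorem commute_subZX_subWX : Commute (subZX : Module.End ℂ (ℤ → FDist₂ M)) subWX := by
  rw [subWX_eq]
  exact (Commute.refl _).sub_right commute_subZW_subZX.symm

theorem subZW_pow_apply (p : ℕ) (F : ℤ → FDist₂ M) (l : ℤ) :
    (subZW ^ p) F l = mulZSubW^[p] (F l) := by
  induction p with
  | zero => rfl
  | succ p ih =>
    rw [pow_succ', Module.End.mul_apply, Function.iterate_succ_apply', ← ih]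
    rfl

theorem subZX_pow_apply (p : ℕ) (F : ℤ → FDist₂ M) (l m k : ℤ) :
    (subZX ^ p) F l m k = mulZSubW^[p] (fun m l => F l m k) m l := by
  induction p generalizing l m with
  | zero => rfl
  | succ p ih =>
    rw [pow_succ', Module.End.mul_apply, Function.iterate_succ_apply']
    simp only [mulZSubW, subZX, LinearMap.coe_mk, AddHom.coe_mk, ← ih]

theorem subWX_pow_apply (p : ℕ) (F : ℤ → FDist₂ M) (l m k : ℤ) :
    (subWX ^ p) F l m k = mulZSubW^[p] (fun k l => F l m k) k l := by
  induction p generalizing l k with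
  | zero => rfl
  | succ p ih =>
    rw [pow_succ', Module.End.mul_apply, Function.iterate_succ_apply']
    simp only [mulZSubW, subWX, LinearMap.coe_mk, AddHom.coe_mk, ← ih]

/-- In the binomial expansion every term has at least p factors f or at least q factors g. The
double induction peels off one factor at a time. -/
theorem sub_pow_apply_eq_zero {E : Type*} [AddCommGroup E] [Module ℂ E] {f g : Module.End ℂ E}
    (hc : Commute f g) {p q : ℕ} {x : E} (hf : (f ^ p) x = 0) (hg : (g ^ q) x = 0) :
    ((g - f) ^ (p + q)) x = 0 := by
  induction p generalizing q x with
  | zero =>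
    obtain rfl : x = 0 := hf
    exact map_zero _
  | succ p ihp =>
    induction q generalizing x with
    | zero =>
      obtain rfl : x = 0 := hg
      exact map_zero _
    | succ q ihq =>
      rw [← add_assoc, pow_succ, Module.End.mul_apply, LinearMap.sub_apply, map_sub]
      have h1 : ((g - f) ^ (p + 1 + q)) (g x) = 0 := by
        refine ihq ?_ ?_
        · rw [← Module.End.mul_apply, (hc.pow_left _).eq, Module.End.mul_apply, hf, map_zero]
        · rwa [← Module.End.mul_apply, ← pow_succ]
      have h2 : ((g - f) ^ (p + (q + 1))) (f x) = 0 := by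
        refine ihp ?_ ?_
        · rwa [← Module.End.mul_apply, ← pow_succ]
        · rw [← Module.End.mul_apply, ← (hc.pow_right _).eq, Module.End.mul_apply, hg, map_zero]
      rw [h1, show p + 1 + q = p + (q + 1) by ring, h2, sub_zero]

/-- A map, additive on a class of distributions, that commutes with multiplication by `z` and by
`w`. -/
structure IsKernelOp (T : FDist₂ M → Prop) (K : FDist₂ M → FDist₂ M) : Prop where
  mem_sub : ∀ X X', T X → T X' → T (X - X')
  mem_shiftZ : ∀ X, T X → T (shiftZ X)
  mem_shiftW : ∀ X, T X → T (shiftW X)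
  map_zero : K 0 = 0
  map_sub : ∀ X X', T X → T X' → K (X - X') = K X - K X'
  map_shiftZ : ∀ X, K (shiftZ X) = shiftZ (K X)
  map_shiftW : ∀ X, K (shiftW X) = shiftW (K X)

theorem expandMul_shiftW (n : ℤ) (X : FDist₂ M) :
    expandMul n (shiftW X) = shiftW (expandMul n X) := by
  ext m k
  simp only [expandMul, shiftW]
  refine finsum_congr fun j => ?_
  rw [add_right_comm]

theorem expandMul_shiftZ (n : ℤ) (X : FDist₂ M) :
    expandMul n (shiftZ X) = shiftZ (expandMul n X) := by
  ext m k
  simp only [expandMul, shiftZ]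
  refine finsum_congr fun j => ?_
  congr 2
  ring

theorem isKernelOp_expandMul (n : ℤ) : IsKernelOp (M := M) TruncW (expandMul n) where
  mem_sub _ _ := TruncW.sub
  mem_shiftZ _ := TruncW.shiftZ
  mem_shiftW _ := TruncW.shiftW
  map_zero := expandMul_zero_right n
  map_sub _ _ := expandMul_sub n
  map_shiftZ := expandMul_shiftZ n
  map_shiftW := expandMul_shiftW n

theorem isKernelOp_expandMul' (n : ℤ) :
    IsKernelOp (M := M) (fun X => TruncW (swapVars X)) (expandMul' n) where
  mem_sub _ _ := TruncW.sub
  mem_shiftZ _ := TruncW.shiftW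
  mem_shiftW _ := TruncW.shiftZ
  map_zero := expandMul'_zero_right n
  map_sub _ _ := expandMul'_sub n
  map_shiftZ X := by
    rw [expandMul', show swapVars (shiftZ X) = shiftW (swapVars X) from rfl, expandMul_shiftW]
    rfl
  map_shiftW X := by
    rw [expandMul', show swapVars (shiftW X) = shiftZ (swapVars X) from rfl, expandMul_shiftZ]
    rfl

/-- Additivity of K is available only on the class T, so membership in T is carried through the
induction with the commutation. -/
theorem IsKernelOp.pow_map {T : FDist₂ M → Prop} {K : FDist₂ M → FDist₂ M}
    {D : Module.End ℂ (ℤ → FDist₂ M)}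
    (hD : ∀ F, (∀ l, T (F l)) → (D fun l => K (F l)) = (fun l => K (D F l)) ∧ ∀ l, T (D F l))
    (p : ℕ) {F : ℤ → FDist₂ M} (hF : ∀ l, T (F l)) :
    ((D ^ p) fun l => K (F l)) = (fun l => K ((D ^ p) F l)) ∧ ∀ l, T ((D ^ p) F l) := by
  induction p with
  | zero => exact ⟨rfl, hF⟩
  | succ p ih =>
    rw [pow_succ', Module.End.mul_apply, Module.End.mul_apply, ih.1]
    exact hD _ ih.2

theorem IsKernelOp.subZX_map {T : FDist₂ M → Prop} {K : FDist₂ M → FDist₂ M} (h : IsKernelOp T K)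
    {F : ℤ → FDist₂ M} (hF : ∀ l, T (F l)) :
    (subZX fun l => K (F l)) = (fun l => K (subZX F l)) ∧ ∀ l, T (subZX F l) := by
  refine ⟨funext fun l => ?_, fun l => h.mem_sub _ _ (h.mem_shiftZ _ (hF l)) (hF (l + 1))⟩
  change _ = K (shiftZ (F l) - F (l + 1))
  rw [h.map_sub _ _ (h.mem_shiftZ _ (hF l)) (hF (l + 1)), h.map_shiftZ]
  rfl

theorem IsKernelOp.subWX_map {T : FDist₂ M → Prop} {K : FDist₂ M → FDist₂ M} (h : IsKernelOp T K)
    {F : ℤ → FDist₂ M} (hF : ∀ l, T (F l)) :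
    (subWX fun l => K (F l)) = (fun l => K (subWX F l)) ∧ ∀ l, T (subWX F l) := by
  refine ⟨funext fun l => ?_, fun l => h.mem_sub _ _ (h.mem_shiftW _ (hF l)) (hF (l + 1))⟩
  change _ = K (shiftW (F l) - F (l + 1))
  rw [h.map_sub _ _ (h.mem_shiftW _ (hF l)) (hF (l + 1)), h.map_shiftW]
  rfl

/-- K acts for each x-mode separately and commutes with z and w, hence with z - x and w - x. -/
theorem IsKernelOp.apply_eq_zero {T : FDist₂ M → Prop} {K : FDist₂ M → FDist₂ M}
    (h : IsKernelOp T K) {p q : ℕ} {F : ℤ → FDist₂ M} (hF : ∀ l, T (F l))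
    (h0 : (subZX ^ p) ((subWX ^ q) F) = 0) :
    (subZX ^ p) ((subWX ^ q) fun l => K (F l)) = 0 := by
  have h1 := IsKernelOp.pow_map (K := K) (fun F hF => h.subWX_map (F := F) hF) q hF
  have h2 := IsKernelOp.pow_map (K := K) (fun F hF => h.subZX_map (F := F) hF) p h1.2
  rw [h1.1, h2.1, h0]
  exact funext fun _ => h.map_zero

/-- Dong's lemma, for the distributions `P = A(z) B(w) C(x)`, `P' = ± B(w) A(z) C(x)`,
`Q = ± C(x) A(z) B(w)`, `Q' = ± C(x) B(w) A(z)` applied to a vector. -/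
theorem dong {P P' Q Q' R R' : ℤ → FDist₂ M} {N : ℕ} (n : ℤ)
    (hP : ∀ l, TruncW (P l)) (hP' : ∀ l, TruncW (swapVars (P' l)))
    (hQ : ∀ l, TruncW (Q l)) (hQ' : ∀ l, TruncW (swapVars (Q' l)))
    (hPP' : ∀ l, mulZSubW^[N] (P l - P' l) = 0) (hQQ' : ∀ l, mulZSubW^[N] (Q l - Q' l) = 0)
    (hPR : (subWX ^ N) (P - R) = 0) (hRQ : (subZX ^ N) (R - Q) = 0)
    (hPR' : (subZX ^ N) (P' - R') = 0) (hRQ' : (subWX ^ N) (R' - Q') = 0) :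
    ∃ L : ℕ, (subWX ^ L) (fun l =>
      (expandMul n (P l) - expandMul' n (P' l)) - (expandMul n (Q l) - expandMul' n (Q' l))) = 0 := by
  set G : ℤ → FDist₂ M := fun l =>
    (expandMul n (P l) - expandMul' n (P' l)) - (expandMul n (Q l) - expandMul' n (Q' l)) with hG
  have hcomm : Commute (subZX ^ N : Module.End ℂ (ℤ → FDist₂ M)) (subWX ^ N) :=
    commute_subZX_subWX.pow_pow N N
  -- C moves past B and then past A through the intermediate order R. The kernels are never applied
  -- to R or R', so these need no truncation.
  have h1 : (subZX ^ N) ((subWX ^ N) (P - Q)) = 0 := by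
    rw [← sub_add_sub_cancel P R Q, map_add, map_add, hPR, map_zero, zero_add,
      ← Module.End.mul_apply, hcomm.eq, Module.End.mul_apply, hRQ, map_zero]
  have h2 : (subZX ^ N) ((subWX ^ N) (P' - Q')) = 0 := by
    rw [← sub_add_sub_cancel P' R' Q', map_add, map_add, hRQ', map_zero, add_zero,
      ← Module.End.mul_apply, hcomm.eq, Module.End.mul_apply, hPR', map_zero]
  have hG1 : (subZW ^ (N + n.natAbs)) G = 0 := by
    funext l
    rw [subZW_pow_apply, hG, ← mulZSubWLin_pow, map_sub, mulZSubWLin_pow, mulZSubWLin_pow,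
      mulZSubW_iterate_expandMul_sub n (hP l) (hP' l) (hPP' l),
      mulZSubW_iterate_expandMul_sub n (hQ l) (hQ' l) (hQQ' l), sub_zero]
    rfl
  have hG' : G = (fun l => expandMul n ((P - Q) l)) - fun l => expandMul' n ((P' - Q') l) := by
    funext l
    change _ = expandMul n (P l - Q l) - expandMul' n (P' l - Q' l)
    rw [hG, expandMul_sub n (hP l) (hQ l), expandMul'_sub n (hP' l) (hQ' l)]
    exact sub_sub_sub_comm _ _ _ _
  have hG2 : (subZX ^ N) ((subWX ^ N) G) = 0 := by
    rw [hG', map_sub, map_sub,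
      (isKernelOp_expandMul n).apply_eq_zero (F := P - Q) (fun l => (hP l).sub (hQ l)) h1,
      (isKernelOp_expandMul' n).apply_eq_zero (F := P' - Q')
        (fun l => TruncW.sub (hP' l) (hQ' l)) h2, sub_zero]
  -- N factors w - x are spent on reaching `hG2`; the other N + |n| + N come from the exponents of z
  -- - w and z - x that kill the result.
  refine ⟨N + n.natAbs + N + N, ?_⟩
  have h3 : (subZW ^ (N + n.natAbs)) ((subWX ^ N) G) = 0 := by
    rw [subWX_eq, ← Module.End.mul_apply, (((Commute.sub_right commute_subZW_subZX
      (Commute.refl _)).pow_pow _ _)).eq, Module.End.mul_apply, hG1, map_zero]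
  rw [pow_add, Module.End.mul_apply]
  nth_rw 1 [subWX_eq]
  exact sub_pow_apply_eq_zero commute_subZW_subZX h3 hG2

end Dong

/-! ### Kernels as explicit sums, delta derivatives, translation -/

section Formal

variable {M : Type*} [AddCommGroup M] [Module ℂ M]

theorem finsum_comp_eq_of_injective {α β M : Type*} [AddCommMonoid M] {f : α → M} {g : β → α}
    (hg : Function.Injective g) (h : Function.support f ⊆ Set.range g) :
    ∑ᶠ j, f (g j) = ∑ᶠ i, f i := by
  rw [← finsum_mem_range hg, ← finsum_mem_univ f]
  refine finsum_mem_inter_support_eq f _ _ ?_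
  rw [Set.univ_inter, Set.inter_eq_right.2 h]

theorem kmul_expandZW (n : ℤ) (X : FDist₂ M) : kmul (expandZW n) X = expandMul n X := by
  ext m k
  rw [kmul, expandMul, ← finsum_comp_eq_of_injective (g := fun j : ℕ => ((n - j, j) : ℤ × ℤ))]
  · refine finsum_congr fun j => ?_
    simp [powerCoeff, expandZW, ofPowers, expandCoeff, add_sub_assoc]
  · intro i j h
    simpa using congrArg Prod.snd h
  · rintro ⟨r, s⟩ h
    have h1 : 0 ≤ s ∧ r + s = n := by
      by_contra h'
      exact h (by simp [powerCoeff, expandZW, ofPowers, h'])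
    exact ⟨s.toNat, by ext <;> simp <;> lia⟩

/-- The kernel lives on the pairs (j, n - j), and its sign (-1)^(n-j) is (-1)^n (-1)^j, matching
(z-w)^n = (-1)^n (w-z)^n. -/
theorem kmul_expandWZ (n : ℤ) (X : FDist₂ M) : kmul (expandWZ n) X = expandMul' n X := by
  ext m k
  simp only [expandMul', Pi.smul_apply, swapVars, expandMul, smul_finsum]
  rw [kmul, ← finsum_comp_eq_of_injective (g := fun j : ℕ => ((j, n - j) : ℤ × ℤ))]
  · refine finsum_congr fun j => ?_
    simp [powerCoeff, expandWZ, ofPowers, expandCoeff, add_sub_assoc, smul_smul,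
      zpow_sub₀ (show (-1 : ℂ) ≠ 0 by norm_num), div_eq_mul_inv, mul_assoc, ← inv_pow]
  · intro i j h
    simpa using congrArg Prod.fst h
  · rintro ⟨r, s⟩ h
    have h1 : 0 ≤ r ∧ r + s = n := by
      by_contra h'
      exact h (by simp [powerCoeff, expandWZ, ofPowers, h'])
    exact ⟨r.toNat, by ext <;> simp <;> lia⟩

theorem iterate_derivW_delta (j : ℕ) (m n : ℤ) :
    derivW^[j] delta m n =
      if m + n = j - 1 then (j.factorial : ℂ) * (Ring.choose m j : ℤ) else 0 := by
  induction j generalizing n with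
  | zero =>
    have : (-m - 1 + (-n - 1) = -1) ↔ m + n = -1 := by lia
    simp [delta, ofPowers, this]
  | succ j ih =>
    rw [Function.iterate_succ_apply', derivW, ih]
    have : m + (n - 1) = j - 1 ↔ m + n = ((j + 1 : ℕ) : ℤ) - 1 := by push_cast; lia
    simp only [this]
    split_ifs with h
    · have hn : (n : ℂ) = j - m := by
        rw [show n = j - m by push_cast at h; lia]
        push_cast
        rfl
      rw [smul_eq_mul, hn, Nat.factorial_succ]
      push_cast
      linear_combination (-(j.factorial : ℂ)) * succ_mul_choose_succ m j
    · simp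

theorem kmul_deltaDeriv (j : ℕ) (c : FDist M) (m n : ℤ) :
    kmul (deltaDeriv j) (inW c) m n = ((Ring.choose m j : ℤ) : ℂ) • c (m + n - j) := by
  -- A distribution constant in z has only the z-mode -1, which fixes r; homogeneity of the delta
  -- derivative then fixes s.
  rw [kmul, finsum_eq_single _ ((-1 - m, m - j) : ℤ × ℤ)]
  · have hj : (j.factorial : ℂ) ≠ 0 := by exact_mod_cast j.factorial_ne_zero
    simp only [powerCoeff, deltaDeriv, Pi.smul_apply, iterate_derivW_delta, inW]
    rw [if_pos (by ring), if_pos (by ring), smul_eq_mul, inv_mul_cancel_left₀ hj,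
      show -(-1 - m) - 1 = m by ring, show n + (m - j) = m + n - j by ring]
  · rintro ⟨r, s⟩ h
    simp only [powerCoeff, deltaDeriv, Pi.smul_apply, iterate_derivW_delta, inW]
    by_cases h1 : m + r = -1
    · rw [if_neg, smul_zero, zero_smul]
      intro h2
      exact h (by ext <;> simp <;> lia)
    · rw [if_neg h1, smul_zero]

/-- Residues against `i_{z,w} (z - w) ^ n` intertwine a derivation that acts as `∂_z + ∂_w` with
`∂_w`. -/
theorem map_expandMul_of_derivation (n : ℤ) {X : FDist₂ M} (h : TruncW X) (T : Module.End ℂ M)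
    (hT : ∀ m k : ℤ, T (X m k) = (-m : ℂ) • X (m - 1) k + (-k : ℂ) • X m (k - 1)) (k : ℤ) :
    T (expandMul n X 0 k) = (-k : ℂ) • expandMul n X 0 (k - 1) := by
  obtain ⟨N, hN⟩ := h.exists_bound (k - 1)
  have h1 : ∀ j : ℕ, N ≤ j → ∀ m, X m (k + j) = 0 := fun j hj m => by
    have := hN (j + 1) (by lia) m
    rwa [show k - 1 + ((j + 1 : ℕ) : ℤ) = k + j by push_cast; ring] at this
  have h2 : ∀ j : ℕ, N + 1 ≤ j → ∀ m, X m (k - 1 + j) = 0 := fun j hj => hN j (by lia)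
  set Z : ℕ → M := fun j => X (n - j) (k - 1 + j) with hZ
  have hA : ∀ j : ℕ, T (expandCoeff n j • X (0 + n - j) (k + j)) =
      ((j + 1 : ℂ) * expandCoeff n (j + 1)) • Z (j + 1) + (-(k + j : ℂ) * expandCoeff n j) • Z j := by
    intro j
    rw [map_smul, hT, expandCoeff_absorb, smul_add, smul_smul, smul_smul, hZ]
    simp only
    rw [show n - ((j + 1 : ℕ) : ℤ) = 0 + n - j - 1 by push_cast; ring,
      show k - 1 + ((j + 1 : ℕ) : ℤ) = k + j by push_cast; ring,
      show k + (j : ℤ) - 1 = k - 1 + j by ring, show 0 + n - (j : ℤ) = n - j by ring]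
    congr 2 <;> push_cast <;> ring
  have hZN : Z N = 0 := hN N le_rfl _
  rw [expandMul_eq_sum n h1, expandMul_eq_sum n hN, map_sum, Finset.sum_congr rfl fun j _ => hA j,
    Finset.sum_add_distrib]
  -- Shifting the index costs nothing: the term j = 0 carries the factor 0, and Z N = 0. What
  -- remains is j - (k + j) = -k.
  have h3 : ∑ j ∈ Finset.range N, ((j + 1 : ℂ) * expandCoeff n (j + 1)) • Z (j + 1) =
      ∑ j ∈ Finset.range N, ((j : ℂ) * expandCoeff n j) • Z j := by
    have h4 := Finset.sum_range_succ' (fun j => ((j : ℂ) * expandCoeff n j) • Z j) N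
    rw [Finset.sum_range_succ, hZN] at h4
    simpa using h4.symm
  rw [h3, ← Finset.sum_add_distrib, Finset.smul_sum]
  refine Finset.sum_congr rfl fun j _ => ?_
  rw [← add_smul, smul_smul, hZ, show 0 + n - (j : ℤ) = n - j by ring]
  congr 1
  ring

/-- A distribution `d(z)` without negative powers of `z`, with `T d = ∂ d` and zero constant term,
vanishes. -/
theorem eq_zero_of_translation {d : FDist M} (T : Module.End ℂ M)
    (hT : ∀ k : ℤ, T (d k) = (-k : ℂ) • d (k - 1)) (h0 : ∀ k : ℤ, -1 ≤ k → d k = 0) : d = 0 := by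
  have h : ∀ p : ℕ, d (-1 - p) = 0 := by
    intro p
    induction p with
    | zero => exact h0 _ (by simp)
    | succ p ih =>
      have := hT (-1 - p)
      rw [ih, map_zero] at this
      -- The factor -k is nonzero for k = -1 - p, so each vanishing mode forces the next lower one
      -- to vanish.
      rcases smul_eq_zero.1 this.symm with h | h
      · exfalso
        rw [neg_eq_zero, Int.cast_eq_zero] at h
        lia
      · rw [← h]
        congr 1
        push_cast
        ring
  ext k
  rcases le_or_gt (-1) k with hk | hk
  · exact h0 k hk
  · have := h (-1 - k).toNat
    rwa [show -1 - (((-1 - k).toNat : ℕ) : ℤ) = k by lia] at this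

end Formal

section Super

variable {V : Type*} [AddCommGroup V] [Module ℂ V] (𝒱 : ZMod 2 → Submodule ℂ V)
  [DirectSum.Decomposition 𝒱]

/-! ### Parity -/

theorem parityProj_apply (i : ZMod 2) (v : V) :
    parityProj 𝒱 i v = (DirectSum.decompose 𝒱 v i : V) := rfl

theorem parityProj_of_mem {i j : ZMod 2} {v : V} (hv : v ∈ 𝒱 j) :
    parityProj 𝒱 i v = if i = j then v else 0 := by
  rw [parityProj_apply]
  split_ifs with h
  · rw [h, DirectSum.decompose_of_mem_same 𝒱 hv]
  · rw [DirectSum.decompose_of_mem_ne 𝒱 hv (Ne.symm h)]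

/-- An endomorphism of parity `d`. -/
def HasParity (d : ZMod 2) (f : Module.End ℂ V) : Prop := ∀ i, ∀ v ∈ 𝒱 i, f v ∈ 𝒱 (i + d)

theorem HasParity.parityPart {d : ZMod 2} {f : Module.End ℂ V} (hf : HasParity 𝒱 d f)
    (e : ZMod 2) : parityPart 𝒱 e f = if e = d then f else 0 := by
  ext v
  induction v using DirectSum.Decomposition.inductionOn 𝒱 with
  | zero => rw [map_zero, map_zero]
  | add u v hu hv => rw [map_add, map_add, hu, hv]
  | @homogeneous j v =>
    rw [VertexAlg.parityPart, LinearMap.sum_apply, Finset.sum_eq_single j]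
    · rw [Module.End.mul_apply, Module.End.mul_apply, parityProj_of_mem 𝒱 v.2, if_pos rfl,
        parityProj_of_mem 𝒱 (hf j _ v.2)]
      simp only [add_right_inj]
      split_ifs <;> rfl
    · intro i _ hi
      rw [Module.End.mul_apply, Module.End.mul_apply, parityProj_of_mem 𝒱 v.2, if_neg hi, map_zero,
        map_zero]
    · simp

/-- The sign `(-1) ^ (d * e)`. -/
def paritySign (d e : ZMod 2) : ℂ := (-1) ^ (d.val * e.val)

theorem paritySign_add_left (i j l : ZMod 2) :
    paritySign (i + j) l = paritySign i l * paritySign j l := by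
  have h : ∀ i j l : ZMod 2, ((i + j).val * l.val) % 2 = (i.val * l.val + j.val * l.val) % 2 := by
    decide
  rw [paritySign, paritySign, paritySign, ← pow_add,
    neg_one_pow_eq_pow_mod_two (n := (i + j).val * l.val), h, ← neg_one_pow_eq_pow_mod_two]

theorem superSwap_of_hasParity {d e : ZMod 2} {f g : Module.End ℂ V} (hf : HasParity 𝒱 d f)
    (hg : HasParity 𝒱 e g) : superSwap 𝒱 f g = paritySign d e • (g * f) := by
  rw [superSwap, Finset.sum_eq_single d, Finset.sum_eq_single e]
  · rw [hf.parityPart, hg.parityPart, if_pos rfl, if_pos rfl]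
    rfl
  · intro e' _ h
    rw [hg.parityPart, if_neg h, zero_mul, smul_zero]
  · simp
  · intro d' _ h
    refine Finset.sum_eq_zero fun e' _ => ?_
    rw [hf.parityPart, if_neg h, mul_zero, smul_zero]
  · simp

theorem parityPart_add (d : ZMod 2) (f g : Module.End ℂ V) :
    parityPart 𝒱 d (f + g) = parityPart 𝒱 d f + parityPart 𝒱 d g := by
  simp only [parityPart, mul_add, add_mul, Finset.sum_add_distrib]

theorem superSwap_add_left (f f' g : Module.End ℂ V) :
    superSwap 𝒱 (f + f') g = superSwap 𝒱 f g + superSwap 𝒱 f' g := by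
  simp only [superSwap, parityPart_add, mul_add, smul_add, Finset.sum_add_distrib]

theorem superSwap_add_right (f g g' : Module.End ℂ V) :
    superSwap 𝒱 f (g + g') = superSwap 𝒱 f g + superSwap 𝒱 f g' := by
  simp only [superSwap, parityPart_add, add_mul, smul_add, Finset.sum_add_distrib]

/-! ### Products of fields -/

theorem truncW_prodVec (A B : VertexOperator ℂ V) (v : V) : TruncW (prodVec A B v) :=
  prodVec_eventually A B v

theorem truncW_swapVec (A B : VertexOperator ℂ V) (v : V) :
    TruncW (swapVars (swapVec 𝒱 A B v)) :=
  swapVec_eventually 𝒱 A B v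

theorem nProduct_ncoeff (A B : VertexOperator ℂ V) (n k : ℤ) (v : V) :
    (nProduct 𝒱 A B n).ncoeff k v =
      expandMul n (prodVec A B v) 0 k - expandMul' n (swapVec 𝒱 A B v) 0 k := by
  rw [nProduct, ncoeff_ofModes, nProductVec, kmul_expandZW, kmul_expandWZ]
  rfl

theorem vertexOperator_ext {A B : VertexOperator ℂ V}
    (h : ∀ k v, A.ncoeff k v = B.ncoeff k v) : A = B := by
  refine HVertexOperator.coeff_inj (funext fun i => ?_)
  rw [VertexOperator.coeff_eq_ncoeff, VertexOperator.coeff_eq_ncoeff]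
  exact LinearMap.ext fun v => h _ v

theorem nProduct_add_left (A A' B : VertexOperator ℂ V) (n : ℤ) :
    nProduct 𝒱 (A + A') B n = nProduct 𝒱 A B n + nProduct 𝒱 A' B n := by
  refine vertexOperator_ext fun k v => ?_
  have h1 : prodVec (A + A') B v = prodVec A B v + prodVec A' B v := by
    ext m k
    simp [prodVec]
  have h2 : swapVec 𝒱 (A + A') B v = swapVec 𝒱 A B v + swapVec 𝒱 A' B v := by
    ext m k
    simp [swapVec, superSwap_add_left]
  rw [map_add, Pi.add_apply, LinearMap.add_apply, nProduct_ncoeff, nProduct_ncoeff,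
    nProduct_ncoeff, h1, h2, expandMul_add n (truncW_prodVec _ _ _) (truncW_prodVec _ _ _),
    expandMul'_add n (truncW_swapVec _ _ _ _) (truncW_swapVec _ _ _ _)]
  exact add_sub_add_comm _ _ _ _

theorem nProduct_add_right (A B B' : VertexOperator ℂ V) (n : ℤ) :
    nProduct 𝒱 A (B + B') n = nProduct 𝒱 A B n + nProduct 𝒱 A B' n := by
  refine vertexOperator_ext fun k v => ?_
  have h1 : prodVec A (B + B') v = prodVec A B v + prodVec A B' v := by
    ext m k
    simp [prodVec]
  have h2 : swapVec 𝒱 A (B + B') v = swapVec 𝒱 A B v + swapVec 𝒱 A B' v := by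
    ext m k
    simp [swapVec, superSwap_add_right]
  rw [map_add, Pi.add_apply, LinearMap.add_apply, nProduct_ncoeff, nProduct_ncoeff,
    nProduct_ncoeff, h1, h2, expandMul_add n (truncW_prodVec _ _ _) (truncW_prodVec _ _ _),
    expandMul'_add n (truncW_swapVec _ _ _ _) (truncW_swapVec _ _ _ _)]
  exact add_sub_add_comm _ _ _ _

theorem nProduct_zero_left (B : VertexOperator ℂ V) (n : ℤ) : nProduct 𝒱 0 B n = 0 := by
  simpa using nProduct_add_left 𝒱 0 0 B n

theorem nProduct_zero_right (A : VertexOperator ℂ V) (n : ℤ) : nProduct 𝒱 A 0 n = 0 := by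
  simpa using nProduct_add_right 𝒱 A 0 0 n

/-- All signed binomials for n = -1 equal 1: the expansion in |z| > |w| picks out the modes of A of
index ≤ -1, the other one those of index ≥ 0, its sign (-1)^(-1) cancelling the minus. -/
theorem nProduct_neg_one (A B : VertexOperator ℂ V) :
    nProduct 𝒱 A B (-1) = normalProduct 𝒱 A B := by
  refine vertexOperator_ext fun k v => ?_
  rw [nProduct_ncoeff, normalProduct, ncoeff_ofModes, diag]
  have hfin := normalVec_finite 𝒱 A B k v
  have hsplit : ∀ m : ℤ, normalVec 𝒱 A B v m (k - 1 - m) =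
      (if m ≤ -1 then normalVec 𝒱 A B v m (k - 1 - m) else 0) +
        (if m ≤ -1 then 0 else normalVec 𝒱 A B v m (k - 1 - m)) := by
    intro m
    split_ifs <;> simp
  rw [finsum_congr hsplit, finsum_add_distrib
    (hfin.subset fun m hm h => hm (by
      rw [show normalVec 𝒱 A B v m (k - 1 - m) = 0 from h, ite_self]))
    (hfin.subset fun m hm h => hm (by
      rw [show normalVec 𝒱 A B v m (k - 1 - m) = 0 from h, ite_self])), sub_eq_add_neg]
  congr 1
  · rw [← finsum_comp_eq_of_injective (g := fun j : ℕ => (-1 - j : ℤ))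
      (fun i j h => by simpa using h), expandMul]
    · refine finsum_congr fun j => ?_
      have hj : (-1 - j : ℤ) ≤ -1 := by lia
      rw [if_pos hj, normalVec, if_pos hj, expandCoeff_neg_one, one_smul,
        show 0 + -1 - (j : ℤ) = -1 - j by ring, show k - 1 - (-1 - (j : ℤ)) = k + j by ring]
    · intro m hm
      have : m ≤ -1 := by
        by_contra h
        exact hm (by simp [h])
      exact ⟨(-1 - m).toNat, by simp only; lia⟩
  · rw [← finsum_comp_eq_of_injective (g := fun j : ℕ => (j : ℤ)) Nat.cast_injective, expandMul']
    · simp only [Pi.smul_apply, swapVars, expandMul, zpow_neg_one, inv_neg, inv_one, neg_one_smul,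
        neg_neg]
      refine finsum_congr fun j => ?_
      have hj : ¬ (j : ℤ) ≤ -1 := by lia
      rw [if_neg hj, normalVec, if_neg hj, expandCoeff_neg_one, one_smul, zero_add,
        show k + -1 - (j : ℤ) = k - 1 - j by ring]
    · intro m hm
      have : 0 ≤ m := by
        by_contra h
        exact hm (by simp [show m ≤ -1 by lia])
      exact ⟨m.toNat, by simp only; lia⟩

end Super

/-! ### The n-product identity in a vertex algebra -/

section Super

variable {V : Type*} [AddCommGroup V] [Module ℂ V] {𝒱 : ZMod 2 → Submodule ℂ V}
  [DirectSum.Decomposition 𝒱]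

theorem fieldDeriv_ncoeff (A : VertexOperator ℂ V) (n : ℤ) (v : V) :
    (fieldDeriv A).ncoeff n v = (-n : ℂ) • A.ncoeff (n - 1) v :=
  ncoeff_ofModes _ _ _ _ n v

namespace VertexAlgebra

variable (S : VertexAlgebra 𝒱)

theorem hasParity_ncoeff {i : ZMod 2} {a : V} (ha : a ∈ 𝒱 i) (n : ℤ) :
    HasParity 𝒱 i ((S.Y a).ncoeff n) := fun j b hb => by
  rw [add_comm]
  exact S.Y_parity i j a ha b hb n

theorem superSwap_eq {i j : ZMod 2} {a b : V} (ha : a ∈ 𝒱 i) (hb : b ∈ 𝒱 j) (m n : ℤ) :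
    superSwap 𝒱 ((S.Y a).ncoeff m) ((S.Y b).ncoeff n) =
      paritySign i j • ((S.Y b).ncoeff n * (S.Y a).ncoeff m) :=
  superSwap_of_hasParity 𝒱 (S.hasParity_ncoeff ha m) (S.hasParity_ncoeff hb n)

theorem swapVec_eq {i j : ZMod 2} {a b : V} (ha : a ∈ 𝒱 i) (hb : b ∈ 𝒱 j) (v : V) :
    swapVec 𝒱 (S.Y a) (S.Y b) v =
      fun m n => paritySign i j • (S.Y b).ncoeff n ((S.Y a).ncoeff m v) := by
  ext m n
  rw [swapVec, S.superSwap_eq ha hb]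
  rfl

theorem exists_locality {i j : ZMod 2} {a b : V} (ha : a ∈ 𝒱 i) (hb : b ∈ 𝒱 j) :
    ∃ N : ℕ, ∀ p, N ≤ p → mulZSubW^[p] (fun m n => (S.Y a).ncoeff m * (S.Y b).ncoeff n -
      paritySign i j • ((S.Y b).ncoeff n * (S.Y a).ncoeff m)) = 0 := by
  obtain ⟨N, hN⟩ := S.locality a b
  refine ⟨N, fun p hp => mulZSubW_iterate_eq_zero_of_le hp ?_⟩
  rw [← hN]
  congr 1
  ext m n : 2
  rw [superComm, S.superSwap_eq ha hb]

theorem T_ncoeff_apply (a : V) (n : ℤ) (v : V) :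
    S.T ((S.Y a).ncoeff n v) =
      (S.Y a).ncoeff n (S.T v) + (-n : ℂ) • (S.Y a).ncoeff (n - 1) v := by
  have h := LinearMap.congr_fun (S.translation a n) v
  rw [fieldDeriv_ncoeff] at h
  rw [← h]
  simp

theorem T_ncoeff_vac (a : V) (n : ℤ) :
    S.T ((S.Y a).ncoeff n S.vac) = (-n : ℂ) • (S.Y a).ncoeff (n - 1) S.vac := by
  rw [T_ncoeff_apply, S.T_vac, map_zero, zero_add]

/-- Both sides of the `n`-product identity agree on the vacuum. -/
theorem nProduct_vac {i j : ZMod 2} {a b : V} (ha : a ∈ 𝒱 i) (hb : b ∈ 𝒱 j) (n k : ℤ) :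
    (nProduct 𝒱 (S.Y a) (S.Y b) n).ncoeff k S.vac =
      (S.Y ((S.Y a).ncoeff n b)).ncoeff k S.vac := by
  have hform : ∀ k, (nProduct 𝒱 (S.Y a) (S.Y b) n).ncoeff k S.vac =
      expandMul n (prodVec (S.Y a) (S.Y b) S.vac) 0 k := by
    intro k
    -- The second term has no residue: both i_{w,z}(z-w)^n and Y(a,z)|0⟩ involve only nonnegative
    -- powers of z.
    rw [nProduct_ncoeff, sub_eq_self, expandMul', Pi.smul_apply, Pi.smul_apply, swapVars, expandMul,
      finsum_eq_zero_of_forall_eq_zero, smul_zero]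
    intro j
    rw [swapVars, S.swapVec_eq ha hb]
    beta_reduce
    rw [S.Y_apply_vac_regular a _ (by lia), map_zero, smul_zero,
      smul_zero]
  refine sub_eq_zero.1 (congrFun (eq_zero_of_translation (d := fun k =>
    (nProduct 𝒱 (S.Y a) (S.Y b) n).ncoeff k S.vac -
      (S.Y ((S.Y a).ncoeff n b)).ncoeff k S.vac) S.T ?_ ?_) k)
  · intro k
    rw [map_sub, S.T_ncoeff_vac, hform, hform, map_expandMul_of_derivation n
      (truncW_prodVec _ _ _) S.T, smul_sub]
    intro m k
    simp only [prodVec, Module.End.mul_apply]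
    rw [T_ncoeff_apply, T_ncoeff_vac, map_smul, add_comm]
  · intro k hk
    -- For k ≥ -1 only j = 0 survives, leaving a_(n) b_(k)|0⟩, which is a_(n)b at k = -1 and zero
    -- beyond.
    have h0 : ∀ j : ℕ, 1 ≤ j → ∀ m, prodVec (S.Y a) (S.Y b) S.vac m (k + j) = 0 := by
      intro j hj m
      rw [prodVec, Module.End.mul_apply, S.Y_apply_vac_regular b _ (by lia), map_zero]
    rw [hform, expandMul_eq_sum n h0, Finset.sum_range_one, expandCoeff_zero_right, one_smul,
      prodVec, Module.End.mul_apply]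
    rcases hk.eq_or_lt with rfl | hk'
    · rw [S.Y_apply_vac]
      simp [S.Y_apply_vac]
    · rw [S.Y_apply_vac_regular b _ (by simp; lia), S.Y_apply_vac_regular _ _ (by lia), map_zero,
        sub_zero]

/-- The `n`-product of two homogeneous states is local, on the vacuum, with a third one. -/
theorem nProduct_locality {i j l : ZMod 2} {a b c : V} (ha : a ∈ 𝒱 i) (hb : b ∈ 𝒱 j)
    (hc : c ∈ 𝒱 l) (n : ℤ) :
    ∃ L : ℕ, ∀ p, L ≤ p → mulZSubW^[p] (fun k q =>
      (nProduct 𝒱 (S.Y a) (S.Y b) n).ncoeff k ((S.Y c).ncoeff q S.vac) - paritySign (i + j) l •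
        (S.Y c).ncoeff q ((nProduct 𝒱 (S.Y a) (S.Y b) n).ncoeff k S.vac)) = 0 := by
  obtain ⟨N₁, h₁⟩ := S.exists_locality ha hb
  obtain ⟨N₂, h₂⟩ := S.exists_locality ha hc
  obtain ⟨N₃, h₃⟩ := S.exists_locality hb hc
  set N := N₁ + N₂ + N₃
  have hab := h₁ N (by lia)
  have hac := h₂ N (by lia)
  have hbc := h₃ N (by lia)
  set A := (S.Y a).ncoeff
  set B := (S.Y b).ncoeff
  set C := (S.Y c).ncoeff
  set Ω := S.vac
  set s := paritySign i j
  set t := paritySign i l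
  set u := paritySign j l
  have key : ∀ (X : FDist₂ (Module.End ℂ V)) (f : Module.End ℂ V →ₗ[ℂ] V), mulZSubW^[N] X = 0 →
      mulZSubW^[N] (fun m k => f (X m k)) = 0 := by
    intro X f hX
    rw [mulZSubW_iterate_map, hX]
    ext
    simp
  -- The orders are ABC → ACB → CAB and BAC → BCA → CBA; each exchange multiplies by its sign among
  -- s, t, u.
  obtain ⟨L, hL⟩ := dong (M := V) (N := N) n
    (P := fun l => prodVec (S.Y a) (S.Y b) (C l Ω))
    (P' := fun l => swapVec 𝒱 (S.Y a) (S.Y b) (C l Ω))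
    (Q := fun l => fun m k => ((t * u) • C l) (prodVec (S.Y a) (S.Y b) Ω m k))
    (Q' := fun l => fun m k => ((t * u) • C l) (swapVec 𝒱 (S.Y a) (S.Y b) Ω m k))
    (R := fun l m k => u • A m (C l (B k Ω)))
    (R' := fun l m k => (s * t) • B k (C l (A m Ω)))
    (fun l => truncW_prodVec _ _ _) (fun l => truncW_swapVec _ _ _ _)
    (fun l => by
      filter_upwards [truncW_prodVec (S.Y a) (S.Y b) Ω] with k hk m
      rw [hk, map_zero])
    (fun l => by
      filter_upwards [truncW_swapVec 𝒱 (S.Y a) (S.Y b) Ω] with k hk m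
      have := hk m
      simp only [swapVars] at this ⊢
      rw [this, map_zero])
    (fun l => by
      rw [← key _ (LinearMap.applyₗ (C l Ω)) hab]
      congr 1
      ext m k
      simp [S.swapVec_eq ha hb, prodVec, A, B, s])
    (fun l => by
      rw [← key _ (((t * u) • C l) ∘ₗ LinearMap.applyₗ Ω) hab]
      congr 1
      ext m k
      simp [S.swapVec_eq ha hb, prodVec, A, B, s, smul_sub, smul_comm (paritySign i j)])
    (by
      ext q m k
      rw [subWX_pow_apply]
      have := congrFun (congrFun (key _ (A m ∘ₗ LinearMap.applyₗ Ω) hbc) k) q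
      simpa [prodVec, A, B] using this)
    (by
      ext q m k
      rw [subZX_pow_apply]
      have := congrFun (congrFun (key _ (u • LinearMap.applyₗ (B k Ω)) hac) m) q
      simpa [prodVec, A, B, smul_sub, smul_smul, mul_comm] using this)
    (by
      ext q m k
      rw [subZX_pow_apply]
      have := congrFun (congrFun (key _ (s • B k ∘ₗ LinearMap.applyₗ Ω) hac) m) q
      simpa [S.swapVec_eq ha hb, A, B, s, smul_sub, smul_smul] using this)
    (by
      ext q m k
      rw [subWX_pow_apply]
      have := congrFun (congrFun (key _ ((s * t) • LinearMap.applyₗ (A m Ω)) hbc) k) q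
      simpa [S.swapVec_eq ha hb, A, B, s, smul_sub, smul_smul, mul_assoc] using this)
  refine ⟨L, fun p hp => mulZSubW_iterate_eq_zero_of_le hp ?_⟩
  refine funext fun k => funext fun q => ?_
  -- The residue in z is the mode 0, and it commutes with w - x.
  have h := congrFun (congrFun (congrFun hL q) 0) k
  rw [subWX_pow_apply] at h
  refine Eq.trans ?_ h
  refine congrArg (fun X => mulZSubW^[L] X k q) (funext fun k => funext fun q => ?_)
  simp only [Pi.sub_apply]
  rw [nProduct_ncoeff, nProduct_ncoeff, expandMul_map _ n (truncW_prodVec _ _ _),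
    expandMul'_map _ n (truncW_swapVec _ _ _ _), ← map_sub, paritySign_add_left]
  rfl

/-- Goddard's uniqueness: agreement on the vacuum spreads to c = c_(-1)|0⟩ by locality with Y(c,x).
-/
theorem Y_ncoeff_of_homogeneous {i j l : ZMod 2} {a b c : V} (ha : a ∈ 𝒱 i) (hb : b ∈ 𝒱 j)
    (hc : c ∈ 𝒱 l) (n k : ℤ) :
    (S.Y ((S.Y a).ncoeff n b)).ncoeff k c = (nProduct 𝒱 (S.Y a) (S.Y b) n).ncoeff k c := by
  obtain ⟨L, hL⟩ := S.nProduct_locality ha hb hc n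
  obtain ⟨L', hL'⟩ := S.exists_locality (S.Y_parity i j a ha b hb n) hc
  have h1 := hL (L + L') (by lia)
  have h2 := hL' (L + L') (by lia)
  have h3 := mulZSubW_iterate_map (LinearMap.applyₗ S.vac : Module.End ℂ V →ₗ[ℂ] V) (L + L')
    (fun k q => (S.Y ((S.Y a).ncoeff n b)).ncoeff k * (S.Y c).ncoeff q -
      paritySign (i + j) l • ((S.Y c).ncoeff q * (S.Y ((S.Y a).ncoeff n b)).ncoeff k))
  rw [h2] at h3
  set D : FDist₂ V := fun k q =>
    (S.Y ((S.Y a).ncoeff n b)).ncoeff k ((S.Y c).ncoeff q S.vac) -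
      (nProduct 𝒱 (S.Y a) (S.Y b) n).ncoeff k ((S.Y c).ncoeff q S.vac) with hD
  have h4 : mulZSubW^[L + L'] D = 0 := by
    -- Both locality relations carry the same sign, as a_(n)b has parity i + j; their second terms
    -- cancel by `nProduct_vac`.
    have h5 := congrArg₂ (· - ·) h3 h1
    simp only [← mulZSubWLin_pow, ← map_sub] at h5
    rw [mulZSubWLin_pow] at h5
    convert h5 using 1
    · congr 1
      ext k q
      simp [hD, S.nProduct_vac ha hb]
    · ext
      simp
  have h6 := eq_zero_of_mulZSubW_iterate _ h4 (fun m q hq => by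
    simp only [hD]
    rw [S.Y_apply_vac_regular c q hq, map_zero, map_zero, sub_zero]) k
  simp only [hD, S.Y_apply_vac] at h6
  exact sub_eq_zero.1 h6

/-- The `n`-product identity. -/
theorem Y_ncoeff (a b : V) (n : ℤ) :
    S.Y ((S.Y a).ncoeff n b) = nProduct 𝒱 (S.Y a) (S.Y b) n := by
  induction a using DirectSum.Decomposition.inductionOn 𝒱 with
  | zero => simp [nProduct_zero_left]
  | add a a' h h' =>
    rw [map_add, nProduct_add_left, ← h, ← h', map_add, Pi.add_apply, LinearMap.add_apply, map_add]
  | @homogeneous i a =>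
    induction b using DirectSum.Decomposition.inductionOn 𝒱 with
    | zero => simp [nProduct_zero_right]
    | add b b' h h' =>
      rw [map_add, map_add, map_add, nProduct_add_right, ← h, ← h']
    | @homogeneous j b =>
      refine vertexOperator_ext fun k c => ?_
      -- The argument c is split too, because it enters the proof as the state of a third field with
      -- a definite sign.
      induction c using DirectSum.Decomposition.inductionOn 𝒱 with
      | zero => rw [map_zero, map_zero]
      | add c c' h h' => rw [map_add, map_add, h, h']
      | @homogeneous l c => exact S.Y_ncoeff_of_homogeneous a.2 b.2 c.2 n k

/-! ### Translation and the commutator formula -/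

theorem T_eq (a : V) : S.T a = (S.Y a).ncoeff (-2) S.vac := by
  have h := S.T_ncoeff_vac a (-1)
  rw [S.Y_apply_vac] at h
  simpa using h

theorem superSwap_vac (a : V) (m n : ℤ) :
    superSwap 𝒱 ((S.Y a).ncoeff m) ((S.Y S.vac).ncoeff n) =
      if n = -1 then (S.Y a).ncoeff m else 0 := by
  induction a using DirectSum.Decomposition.inductionOn 𝒱 with
  | zero => simpa using superSwap_add_left 𝒱 0 0 ((S.Y S.vac).ncoeff n)
  | add a a' h h' =>
    rw [map_add, map_add, Pi.add_apply, superSwap_add_left, h, h']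
    split_ifs <;> simp
  | @homogeneous i a =>
    rw [S.superSwap_eq a.2 S.vac_even, S.Y_vac]
    split_ifs <;> simp [paritySign]

theorem Y_T (a : V) : S.Y (S.T a) = fieldDeriv (S.Y a) := by
  rw [T_eq, Y_ncoeff]
  refine vertexOperator_ext fun k v => ?_
  rw [nProduct_ncoeff, fieldDeriv_ncoeff]
  have h1 : prodVec (S.Y a) (S.Y S.vac) v =
      fun m n => if n = -1 then (S.Y a).ncoeff m v else 0 := by
    ext m n
    rw [prodVec, S.Y_vac]
    split_ifs <;> simp
  have h2 : swapVec 𝒱 (S.Y a) (S.Y S.vac) v =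
      fun m n => if n = -1 then (S.Y a).ncoeff m v else 0 := by
    ext m n
    rw [swapVec, S.superSwap_vac]
    split_ifs <;> simp
  rw [h1, h2]
  simp only [expandMul', Pi.smul_apply, swapVars, expandMul, expandCoeff_neg_two]
  -- Only the vacuum mode -1 contributes. For k < 0 it occurs in the first expansion alone, at j =
  -- -1 - k; for k > 0 in the second alone, at j = k - 1; for k = 0 in neither. The coefficient j +
  -- 1 yields -k in both cases.
  rcases lt_trichotomy k 0 with hk | rfl | hk
  · rw [finsum_eq_single _ (-1 - k).toNat, finsum_eq_zero_of_forall_eq_zero, smul_zero, sub_zero,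
      if_pos (by lia)]
    · have h : ((((-1 - k).toNat : ℕ) : ℤ) : ℂ) = ((-1 - k : ℤ) : ℂ) := by
        congr 1; lia
      rw [Int.cast_natCast] at h
      rw [h]
      congr 1
      · push_cast; ring
      · exact congrArg (fun m => (S.Y a).ncoeff m v) (by lia)
    · intro j
      rw [if_neg (by lia), smul_zero]
    · intro j hj
      rw [if_neg (by lia), smul_zero]
  · rw [finsum_eq_zero_of_forall_eq_zero, finsum_eq_zero_of_forall_eq_zero]
    · simp
    · intro j
      rw [if_neg (by lia), smul_zero]
    · intro j
      rw [if_neg (by lia), smul_zero]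
  · rw [finsum_eq_zero_of_forall_eq_zero, finsum_eq_single _ (k - 1).toNat, zero_sub,
      if_pos (by lia)]
    · have h : ((((k - 1).toNat : ℕ) : ℤ) : ℂ) = ((k - 1 : ℤ) : ℂ) := by
        congr 1; lia
      rw [Int.cast_natCast] at h
      rw [h, show (-1 : ℂ) ^ (-2 : ℤ) = 1 by norm_num, one_smul, ← neg_smul]
      congr 1
      · push_cast; ring
      · exact congrArg (fun m => (S.Y a).ncoeff m v) (by lia)
    · intro j hj
      rw [if_neg (by lia), smul_zero]
    · intro j
      rw [if_neg (by lia), smul_zero]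

theorem finite_ncoeff_ne_zero (a b : V) : {j : ℕ | (S.Y a).ncoeff j b ≠ 0}.Finite := by
  obtain ⟨N, hN⟩ := eventually_atTop.1 (ncoeff_eventually (S.Y a) b)
  refine (Set.finite_lt_nat N.toNat).subset fun j hj => ?_
  by_contra h
  exact hj (hN j (by simp at h; lia))

/-- For a natural exponent both expansions are multiplication by the polynomial (z-w)^j, so the
n-product is a residue of the supercommutator. -/
theorem ncoeff_Y_ncoeff_natCast (a b : V) (j : ℕ) (k : ℤ) :
    (S.Y ((S.Y a).ncoeff j b)).ncoeff k = mulZSubW^[j] (superComm 𝒱 (S.Y a) (S.Y b)) 0 k := by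
  ext v
  have h := mulZSubW_iterate_map (LinearMap.applyₗ v : Module.End ℂ V →ₗ[ℂ] V) j
    (superComm 𝒱 (S.Y a) (S.Y b))
  have h' : (fun m k => (LinearMap.applyₗ v : Module.End ℂ V →ₗ[ℂ] V)
      (superComm 𝒱 (S.Y a) (S.Y b) m k)) =
      prodVec (S.Y a) (S.Y b) v - swapVec 𝒱 (S.Y a) (S.Y b) v := rfl
  rw [h', ← mulZSubWLin_pow, map_sub, mulZSubWLin_pow, mulZSubWLin_pow] at h
  rw [Y_ncoeff, nProduct_ncoeff, expandMul_natCast _ (truncW_prodVec _ _ _),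
    expandMul'_natCast _ (truncW_swapVec _ _ _ _)]
  exact congrFun (congrFun h 0) k

/-- The commutator formula. -/
theorem superComm_eq_finsum (a b : V) :
    superComm 𝒱 (S.Y a) (S.Y b) =
      ∑ᶠ j : ℕ, kmul (deltaDeriv j) (inW (S.Y ((S.Y a).ncoeff j b)).ncoeff) := by
  obtain ⟨N, hN⟩ := S.locality a b
  have hterm : ∀ j : ℕ, kmul (deltaDeriv j) (inW (S.Y ((S.Y a).ncoeff j b)).ncoeff) =
      fun m n => ((Ring.choose m j : ℤ) : ℂ) •
        mulZSubW^[j] (superComm 𝒱 (S.Y a) (S.Y b)) 0 (m + n - j) := by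
    intro j
    ext m n : 2
    rw [kmul_deltaDeriv, ncoeff_Y_ncoeff_natCast]
  -- Terms with j ≥ N vanish identically, since (z-w)^N already kills the supercommutator.
  rw [finsum_eq_sum_of_support_subset (s := Finset.range N)]
  · ext m n : 2
    rw [eq_sum_choose_of_isLocal N hN, Finset.sum_apply, Finset.sum_apply]
    exact Finset.sum_congr rfl fun j _ => by rw [hterm]
  · intro j hj
    by_contra h
    refine hj ?_
    beta_reduce
    rw [hterm, mulZSubW_iterate_eq_zero_of_le (by simpa using h) hN]
    ext m n : 2
    exact smul_zero _

end VertexAlgebra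

end Super

end VertexAlg

end

theorem mainTheorem1 {V : Type*} [AddCommGroup V] [Module ℂ V] (𝒱 : ZMod 2 → Submodule ℂ V)
    [DirectSum.Decomposition 𝒱] (S : VertexAlg.VertexAlgebra 𝒱) (a b : V) :
    (∀ n : ℤ, S.Y ((S.Y a).ncoeff n b) = VertexAlg.nProduct 𝒱 (S.Y a) (S.Y b) n) ∧
    S.Y ((S.Y a).ncoeff (-1) b) = VertexAlg.normalProduct 𝒱 (S.Y a) (S.Y b) ∧
    S.Y (S.T a) = VertexAlg.fieldDeriv (S.Y a) ∧
    {j : ℕ | (S.Y a).ncoeff j b ≠ 0}.Finite ∧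
    VertexAlg.superComm 𝒱 (S.Y a) (S.Y b) =
      ∑ᶠ j : ℕ, VertexAlg.kmul (VertexAlg.deltaDeriv j)
        (VertexAlg.inW (S.Y ((S.Y a).ncoeff j b)).ncoeff) :=
  ⟨S.Y_ncoeff a b, (S.Y_ncoeff a b (-1)).trans (VertexAlg.nProduct_neg_one 𝒱 _ _), S.Y_T a,
    S.finite_ncoeff_ne_zero a b, S.superComm_eq_finsum a b⟩
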